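/- Let $\mathcal P$ be a finite triangulated region in the plane with $n$ vertices, each triangle $f$ carrying a positive weight $w_f$; let $w_{\max}, w_{\min}$ be the largest and smallest weights and $\mu = w_{\max}/w_{\min}$. The weight at a point is the smallest weight of the triangles containing it (so $w_f$ inside $f$, and $\min(w_f,w_g)$ on an edge shared by $f$ and $g$; points outside $\mathcal P$ are charged $w_{\max}$). The weighted Euclidean distance of a line segment is the integral of the weight along it. A ray starts at a source, traverses a sequence of triangles $f_1,\dots,f_{p+1}$, consecutive ones sharing an edge, and crosses the shared edges $e_1,\dots,e_p$ away from the vertices. At each $e_i$ it refracts by Snell's law $w_{f_i}\sin\theta_i' = w_{f_{i+1}}\sin\theta_{i+1}$, where the angle of incidence $\theta_i'$ and the angle of refraction $\theta_{i+1}$ are measured from the normal of the edge and are less than $\pi/2$. Distance along a ray is measured with the weights of the triangles traversed. From every source $o$ a finite set $\mathcal R(o)$ of rays is initiated. The tree of rays $\mathcal T_R(u)$ of a vertex $u$ has $u$ as its root. When a ray initiated from a node, after refracting across some edges, strikes an edge at a non-vertex point at the critical angle $\arcsin(w_g/w_f)$, passing from $f$ towards a lighter face $g$, this point is a child of that node (a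 critical source), from which Steiner rays into $g$ are initiated. A bundle of rays from a node $o$ of $\mathcal T_R(u)$ is a maximal set of successive rays of $\mathcal R(o)$ that cross the same edge sequence $e_1,\dots,e_p$. Two rays are successive if no ray of $\mathcal R(o)$ lies between them in the angular order around $o$. Claim. There is a constant $\varepsilon_0>0$, depending only on the weighted triangulation $\mathcal P$, such that the following holds for every $\varepsilon'\in(0,\varepsilon_0]$, for every vertex $u$ and for all choices of the sets $\mathcal R(o)$. Let $r', r''$ be two successive rays, initiated from the same node $o$ of $\mathcal T_R(u)$, in a bundle with edge sequence $e_1,\dots,e_p$. Suppose that the number of edges met from $u$ along the tree to $o$, plus $p$, is at most $n^2$, and that whenever $r'$ or $r''$ enters a lighter triangle, its angle of refraction is at most $\frac{\pi}{2}-\varepsilon'$. Suppose also that the angle between $r'$ and $r''$ at $o$ is at most $$\frac{(\varepsilon')^{n^2}\,\varepsilon'}{2\mu}.$$ If $q'$ and $q''$ are points of $r'$ and $r''$, traced through $f_1,\dots,f_{p+1}$, at equal weighted Euclidean distance $d$ from $o$ along the respective ray, then the weighted Euclidean distance of the line segment $q'q''$ is at most $d\,\varepsilon'$. The points $q'$ and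 $q''$ need not lie on the same face. -/

import Mathlib

namespace WSP

/-- The Euclidean plane. -/
abbrev Plane := EuclideanSpace ℝ (Fin 2)

/-- A finite triangulated region of the plane whose triangles carry positive weights.
A triangle is given by the finset of its three vertices. -/
structure WeightedTriangulation where
  /-- the triangulation, as a geometric simplicial complex -/
  K : Geometry.SimplicialComplex ℝ Plane
  /-- its triangular faces -/
  triangles : Finset (Finset Plane)
  mem_triangles : ∀ f, f ∈ triangles ↔ f ∈ K.faces ∧ f.card = 3
  /-- every vertex and every edge belongs to some triangle -/
  pure : ∀ s ∈ K.faces, ∃ f ∈ triangles, s ⊆ f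
  nonempty : triangles.Nonempty
  /-- the weight of a triangle (values off `triangles` are irrelevant) -/
  weight : Finset Plane → ℝ
  weight_pos : ∀ f ∈ triangles, 0 < weight f

namespace WeightedTriangulation

variable (T : WeightedTriangulation)

/-- `n`, the number of vertices. -/
noncomputable def n : ℕ := T.K.vertices.ncard

noncomputable def wMax : ℝ := T.triangles.sup' T.nonempty T.weight

noncomputable def wMin : ℝ := T.triangles.inf' T.nonempty T.weight

/-- `μ`, the ratio of the largest to the smallest weight. -/
noncomputable def mu : ℝ := T.wMax / T.wMin

open Classical in
/-- The weight charged at a point: the least weight of the triangles containing it. So it is `w_f`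
inside a face `f` and `min (w_f) (w_g)` on an edge shared by `f` and `g`. A point outside the
region is charged the largest weight. -/
noncomputable def pointWeight (x : Plane) : ℝ :=
  T.triangles.inf' T.nonempty
    (fun f => if x ∈ convexHull ℝ (f : Set Plane) then T.weight f else T.wMax)

/-- The weighted Euclidean distance of the line segment joining `a` and `b`: the integral of the
weight along the segment with respect to arc length. -/
noncomputable def segmentCost (a b : Plane) : ℝ :=
  ∫ t in (0 : ℝ)..1, T.pointWeight (AffineMap.lineMap a b t) * ‖b - a‖

theorem measurable_pointWeight : Measurable T.pointWeight := by
  classical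
  have h : T.pointWeight = T.triangles.inf' T.nonempty
      (fun f x => if x ∈ convexHull ℝ (f : Set Plane) then T.weight f else T.wMax) := by
    funext x
    rw [Finset.inf'_apply]
    unfold pointWeight
    congr
  rw [h]
  refine Finset.inf'_induction T.nonempty _ (p := Measurable) (fun _ h₁ _ h₂ => h₁.inf h₂) ?_
  intro f _
  exact Measurable.ite (f.finite_toSet.isClosed_convexHull ℝ).measurableSet
    measurable_const measurable_const

theorem abs_pointWeight_le (x : Plane) : |T.pointWeight x| ≤ T.wMax := by
  have hle : ∀ f ∈ T.triangles, T.weight f ≤ T.wMax := fun f hf => Finset.le_sup' T.weight hf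
  obtain ⟨f, hf⟩ := T.nonempty
  have hpos : 0 < T.wMax := (T.weight_pos f hf).trans_le (hle f hf)
  rw [abs_le]
  constructor
  · refine le_trans (by linarith : -T.wMax ≤ 0) ?_
    unfold pointWeight
    refine Finset.le_inf' _ _ (fun g hg => ?_)
    split_ifs
    · exact (T.weight_pos g hg).le
    · exact hpos.le
  · unfold pointWeight
    refine (Finset.inf'_le _ hf).trans ?_
    split_ifs
    · exact hle f hf
    · exact le_rfl

/-- The integral in `segmentCost` always exists. -/
theorem intervalIntegrable_segmentCost (a b : Plane) :
    IntervalIntegrable (fun t : ℝ => T.pointWeight (AffineMap.lineMap a b t) * ‖b - a‖)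
      MeasureTheory.volume 0 1 := by
  have hm : Measurable (fun t : ℝ => T.pointWeight (AffineMap.lineMap a b t)) :=
    T.measurable_pointWeight.comp (AffineMap.lineMap_continuous).measurable
  refine IntervalIntegrable.mul_const ?_ _
  refine IntervalIntegrable.mono_fun
    (g := fun t : ℝ => T.pointWeight (AffineMap.lineMap a b t)) (f := fun _ => T.wMax)
    intervalIntegrable_const hm.aestronglyMeasurable ?_
  refine Filter.Eventually.of_forall (fun t => ?_)
  simp only [Real.norm_eq_abs]
  exact (T.abs_pointWeight_le _).trans (le_abs_self _)

end WeightedTriangulation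

open Classical in
/-- The common vertices of two triangles; an edge when there are exactly two. -/
noncomputable def sharedEdge (f g : Finset Plane) : Finset Plane := f ∩ g

/-- The points of an edge other than its endpoints (empty if `e` does not have two elements). -/
def edgeInterior (e : Finset Plane) : Set Plane :=
  {x | ∃ a b : Plane, a ≠ b ∧ (e : Set Plane) = {a, b} ∧ x ∈ openSegment ℝ a b}

/-- `ν` is the unit normal of the edge shared by the triangles `f` and `g` that points into `g`. -/
def IsEdgeNormal (f g : Finset Plane) (ν : Plane) : Prop :=
  ‖ν‖ = 1 ∧
  (∀ a ∈ sharedEdge f g, ∀ b ∈ sharedEdge f g, inner ℝ ν (b - a) = 0) ∧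
  (∀ a ∈ sharedEdge f g, ∀ c ∈ g, c ∉ f → 0 < inner ℝ ν (c - a))

/-- A ray with unit direction `v` in `f` refracts at the edge shared with `g` to the unit direction
`v'` in `g`. The angles of incidence and refraction, measured from the normal `ν`, are less than
`π / 2`, and the last equation is Snell's law: the tangential components of `v` and `v'` have norms
`sin (angle ν v)` and `sin (angle ν v')`, and they point to the same side of the normal. -/
def Refracts (T : WeightedTriangulation) (f g : Finset Plane) (v v' : Plane) : Prop :=
  ∃ ν : Plane, IsEdgeNormal f g ν ∧
    InnerProductGeometry.angle ν v < Real.pi / 2 ∧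
    InnerProductGeometry.angle ν v' < Real.pi / 2 ∧
    T.weight f • (v - inner ℝ ν v • ν) = T.weight g • (v' - inner ℝ ν v' • ν)

/-- A ray with unit direction `v` in `f` is incident at the critical angle to the edge shared with
the lighter triangle `g`. -/
def IsCritical (T : WeightedTriangulation) (f g : Finset Plane) (v : Plane) : Prop :=
  T.weight g < T.weight f ∧
  ∃ ν : Plane, IsEdgeNormal f g ν ∧
    InnerProductGeometry.angle ν v = Real.arcsin (T.weight g / T.weight f)

/-- The break points of the polygonal path that starts at `o` and whose `i`-th segment has
direction `dir i` and length `len i`. -/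
noncomputable def breakPoint (o : Plane) (dir : ℕ → Plane) (len : ℕ → ℝ) : ℕ → Plane
  | 0 => o
  | i + 1 => breakPoint o dir len i + len i • dir i

/-- A (traced) ray: a polygonal path that starts at `source`, traverses the triangles
`face 0, …, face p` in this order, crosses the `p` edges between consecutive ones in their
relative interiors, refracting there by Snell's law, and so far ends in `face p`. Values of `face`,
`dir` and `len` at indices larger than `p` are irrelevant. -/
structure Ray (T : WeightedTriangulation) where
  source : Plane
  p : ℕ
  face : ℕ → Finset Plane
  dir : ℕ → Plane
  len : ℕ → ℝ
  face_mem : ∀ i ≤ p, face i ∈ T.triangles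
  source_mem : source ∈ convexHull ℝ (face 0 : Set Plane)
  norm_dir : ∀ i ≤ p, ‖dir i‖ = 1
  len_pos : ∀ i < p, 0 < len i
  len_nonneg : 0 ≤ len p
  cross : ∀ i < p,
    breakPoint source dir len (i + 1) ∈ edgeInterior (sharedEdge (face i) (face (i + 1)))
  end_mem : breakPoint source dir len (p + 1) ∈ convexHull ℝ (face p : Set Plane)
  refracts : ∀ i < p, Refracts T (face i) (face (i + 1)) (dir i) (dir (i + 1))

namespace Ray

variable {T : WeightedTriangulation}

/-- The current endpoint of a ray. -/
noncomputable def tip (r : Ray T) : Plane := breakPoint r.source r.dir r.len (r.p + 1)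

/-- `q` is the point of the ray `r` at weighted Euclidean distance `d` from its source, measured
along `r`. -/
def PointAt (r : Ray T) (d : ℝ) (q : Plane) : Prop :=
  ∃ k ≤ r.p, ∃ s : ℝ, 0 ≤ s ∧ s ≤ r.len k ∧
    q = breakPoint r.source r.dir r.len k + s • r.dir k ∧
    d = ∑ i ∈ Finset.range k, T.weight (r.face i) * r.len i + T.weight (r.face k) * s

/-- Where `r` enters a lighter face, its angle of refraction is at most `π / 2 - ε`, that is, its
angle of incidence stays away from the critical angle. -/
def AwayFromCritical (r : Ray T) (ε : ℝ) : Prop :=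
  ∀ i < r.p, T.weight (r.face (i + 1)) < T.weight (r.face i) →
    ∀ ν, IsEdgeNormal (r.face i) (r.face (i + 1)) ν →
      InnerProductGeometry.angle ν (r.dir (i + 1)) ≤ Real.pi / 2 - ε

end Ray

/-- The sources of the tree of rays of the vertex `u`, where `R o` is the finite set of initial
directions of the rays initiated from the point `o`. `IsSource T R u k o f` says that `o` is a
node of the tree from which rays are initiated into the triangle `f`, and that `k` edges are met
on the way from `u` to `o` along the tree. The root is `u` itself. If a ray initiated from a node
refracts across some edges and then strikes an edge, at a point that is not a vertex, at the
critical angle, then that point is a critical source and a child of the node; Steiner rays are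
initiated from it into the lighter face beyond the edge. -/
inductive IsSource (T : WeightedTriangulation) (R : Plane → Finset Plane) (u : Plane) :
    ℕ → Plane → Finset Plane → Prop
  | root (f : Finset Plane) (hu : u ∈ T.K.vertices) (hf : f ∈ T.triangles) (huf : u ∈ f) :
      IsSource T R u 0 u f
  | critical (k : ℕ) (r : Ray T) (g : Finset Plane)
      (hsource : IsSource T R u k r.source (r.face 0))
      (hdir : r.dir 0 ∈ R r.source)
      (hlen : 0 < r.len r.p)
      (hg : g ∈ T.triangles)
      (htip : r.tip ∈ edgeInterior (sharedEdge (r.face r.p) g))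
      (hcrit : IsCritical T (r.face r.p) g (r.dir r.p)) :
      IsSource T R u (k + r.p + 1) r.tip g

/-- The cone of positive linear combinations of two vectors. -/
def openCone (v v' : Plane) : Set Plane :=
  {x | ∃ a b : ℝ, 0 < a ∧ 0 < b ∧ x = a • v + b • v'}

/-- Two of the directions in `D` are successive: no direction of `D` lies between them. -/
def Successive (D : Finset Plane) (v v' : Plane) : Prop :=
  v ∈ D ∧ v' ∈ D ∧ ∀ x ∈ D, x ∉ openCone v v'

/-- `r` starts at `o` and crosses, so far, exactly the edges between consecutive triangles of
`face 0, …, face p`. -/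
def Traverses {T : WeightedTriangulation} (r : Ray T) (o : Plane) (p : ℕ)
    (face : ℕ → Finset Plane) : Prop :=
  r.source = o ∧ r.p = p ∧ ∀ i ≤ p, r.face i = face i

/-- A ray bundle in the tree of rays of `u`, with rays initiated from the node `source`: a maximal
set of successive rays of `R source` that all cross the same edge sequence. A ray is identified by
its initial direction. -/
structure Bundle (T : WeightedTriangulation) (R : Plane → Finset Plane) (u : Plane) where
  source : Plane
  /-- the number of edges met on the way from `u` to `source` along the tree -/
  depth : ℕ
  p : ℕ
  face : ℕ → Finset Plane
  isSource : IsSource T R u depth source (face 0)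
  dirs : Set Plane
  maximal_dirs : Maximal (fun D : Set Plane =>
    (∀ v ∈ D, v ∈ R source) ∧
    (∀ v ∈ D, ∃ r : Ray T, Traverses r source p face ∧ r.dir 0 = v) ∧
    (∀ v ∈ D, ∀ v' ∈ D, ∀ x ∈ R source, x ∈ openCone v v' → x ∈ D)) dirs

/-- `r`, traced across the edge sequence of the bundle `B`, is one of the rays of `B`. -/
def Bundle.HasRay {T : WeightedTriangulation} {R : Plane → Finset Plane} {u : Plane}
    (B : Bundle T R u) (r : Ray T) : Prop :=
  Traverses r B.source B.p B.face ∧ r.dir 0 ∈ B.dirs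

end WSP

/-! Fix a source `o`, a length `p` and a sequence of triangles. Refraction keeps the two sides of a
reference ray apart, and this forces every ray of that type to meet the edges with incidence angles
uniformly away from `π / 2` (`Trace.exists_uniform_lower_bound`). Hence a crossing multiplies the
discrepancy of two rays in position and direction (`Trace.gap`) by at most a constant, or a constant
over `ε` on entering a lighter triangle (`Trace.gap_succ_le`). There are at most `n ^ 2` triangles,
so at most `n ^ 2` crossings contain fewer than `n ^ 2` entries into lighter ones
(`card_lighter_lt`). The initial gap is at most `ε ^ (n ^ 2 + 1)`, so every later gap is `O(ε ^ 2)`,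
and so is the distance of points at equal cost (`Trace.norm_sub_le_of_cost_eq`). Past the first edge
`d` is bounded below, so small `ε` gives the bound `d * ε`; inside the first triangle the angle
bound gives it directly. The threshold for `ε` depends on the source and the sequence. Only finitely
many of each occur within `n ^ 2` edges, whatever rays are initiated: critical directions are finite
in number, and a last direction determines the whole path (`finite_sources`,
`Trace.eq_of_dir_last`). -/

open Filter Topology

namespace WSP

/-! ### Plane geometry in an orthonormal frame `(ν, rot ν)` -/

theorem inner_coord (x y : Plane) : inner ℝ x y = x 0 * y 0 + x 1 * y 1 := by
  simp [PiLp.inner_apply, Fin.sum_univ_two, mul_comm]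

theorem norm_sq_coord (x : Plane) : ‖x‖ ^ 2 = x 0 ^ 2 + x 1 ^ 2 := by
  rw [← real_inner_self_eq_norm_sq, inner_coord]; ring

theorem sq_add_sq_of_norm_eq_one {x : Plane} (h : ‖x‖ = 1) : x 0 ^ 2 + x 1 ^ 2 = 1 := by
  rw [← norm_sq_coord, h, one_pow]

/-- Rotation by a quarter turn to the left. -/
noncomputable def rot (v : Plane) : Plane := !₂[-v 1, v 0]

@[simp] theorem rot_zero_coord (v : Plane) : rot v 0 = -v 1 := rfl
@[simp] theorem rot_one_coord (v : Plane) : rot v 1 = v 0 := rfl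

theorem norm_rot (v : Plane) : ‖rot v‖ = ‖v‖ := by
  have h : ‖rot v‖ ^ 2 = ‖v‖ ^ 2 := by
    rw [norm_sq_coord, norm_sq_coord, rot_zero_coord, rot_one_coord]; ring
  exact (sq_eq_sq₀ (norm_nonneg _) (norm_nonneg _)).mp h

theorem inner_rot_self (v : Plane) : inner ℝ v (rot v) = (0 : ℝ) := by
  rw [inner_coord, rot_zero_coord, rot_one_coord]; ring

theorem inner_rot_rot (v w : Plane) : inner ℝ (rot v) (rot w) = (inner ℝ v w : ℝ) := by
  simp only [inner_coord, rot_zero_coord, rot_one_coord]; ring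

theorem inner_rot_left (v w : Plane) : inner ℝ (rot v) w = -(inner ℝ v (rot w) : ℝ) := by
  simp only [inner_coord, rot_zero_coord, rot_one_coord]; ring

theorem eq_frame {ν : Plane} (hν : ‖ν‖ = 1) (v : Plane) :
    v = (inner ℝ ν v : ℝ) • ν + (inner ℝ (rot ν) v : ℝ) • rot ν := by
  have h := sq_add_sq_of_norm_eq_one hν
  ext i
  fin_cases i
  · simp only [inner_coord, rot_zero_coord, rot_one_coord, PiLp.add_apply, PiLp.smul_apply,
      smul_eq_mul, Fin.zero_eta]
    linear_combination (-v 0) * h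
  · simp only [inner_coord, rot_zero_coord, rot_one_coord, PiLp.add_apply, PiLp.smul_apply,
      smul_eq_mul, Fin.mk_one]
    linear_combination (-v 1) * h

theorem inner_frame {ν : Plane} (hν : ‖ν‖ = 1) (v w : Plane) :
    (inner ℝ v w : ℝ) = inner ℝ ν v * inner ℝ ν w + inner ℝ (rot ν) v * inner ℝ (rot ν) w := by
  have h := sq_add_sq_of_norm_eq_one hν
  simp only [inner_coord, rot_zero_coord, rot_one_coord]
  linear_combination (-(v 0 * w 0 + v 1 * w 1)) * h

/-- The number `inner ℝ (rot v) w` is the determinant of `(v, w)`: its sign tells on which side of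
`v` the vector `w` lies. A rotation of the frame preserves it. -/
theorem cross_frame {ν : Plane} (hν : ‖ν‖ = 1) (v w : Plane) :
    (inner ℝ (rot v) w : ℝ) =
      inner ℝ ν v * inner ℝ (rot ν) w - inner ℝ (rot ν) v * inner ℝ ν w := by
  have h := sq_add_sq_of_norm_eq_one hν
  simp only [inner_coord, rot_zero_coord, rot_one_coord]
  linear_combination (-(v 0 * w 1 - v 1 * w 0)) * h

theorem sq_add_sq_frame {ν v : Plane} (hν : ‖ν‖ = 1) (hv : ‖v‖ = 1) :
    (inner ℝ ν v : ℝ) ^ 2 + (inner ℝ (rot ν) v : ℝ) ^ 2 = 1 := by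
  have h := inner_frame hν v v
  rw [real_inner_self_eq_norm_sq, hv] at h
  linear_combination -h

theorem abs_inner_le {ν : Plane} (hν : ‖ν‖ = 1) (v : Plane) : |(inner ℝ ν v : ℝ)| ≤ ‖v‖ := by
  simpa [hν] using abs_real_inner_le_norm ν v

theorem norm_le_frame {ν : Plane} (hν : ‖ν‖ = 1) (v : Plane) :
    ‖v‖ ≤ |(inner ℝ ν v : ℝ)| + |(inner ℝ (rot ν) v : ℝ)| := by
  conv_lhs => rw [eq_frame hν v]
  refine (norm_add_le _ _).trans ?_
  simp [norm_smul, norm_rot, hν]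

/-- The sine is increasing on directions in a half plane. -/
theorem cross_nonneg_of_le {n t m s : ℝ} (hn : 0 < n) (hm : 0 < m) (h : n ^ 2 + t ^ 2 = 1)
    (h' : m ^ 2 + s ^ 2 = 1) (hst : s ≤ t) : 0 ≤ m * t - s * n := by
  rcases le_total 0 t with ht | ht
  · rcases le_total s 0 with hs | hs
    · nlinarith
    · have : n ≤ m := by nlinarith
      nlinarith
  · have : m ≤ n := by nlinarith
    nlinarith

/-- Translates "which direction is to the left" into a comparison of sines, the quantities that
Snell's law controls. -/
theorem cross_nonneg_iff {n t m s : ℝ} (hn : 0 < n) (hm : 0 < m) (h : n ^ 2 + t ^ 2 = 1)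
    (h' : m ^ 2 + s ^ 2 = 1) : 0 ≤ m * t - s * n ↔ 0 ≤ t - s := by
  constructor
  · intro hc
    by_contra hlt
    have hts : t < s := by linarith
    have h2 := cross_nonneg_of_le hm hn h' h hts.le
    have h3 : m * t = s * n := by linarith
    have h4 : t ^ 2 = s ^ 2 := by
      have : m ^ 2 * t ^ 2 = s ^ 2 * n ^ 2 := by rw [← mul_pow, h3, mul_pow]
      rw [show m ^ 2 = 1 - s ^ 2 by linarith, show n ^ 2 = 1 - t ^ 2 by linarith] at this
      linarith
    have h5 : t = -s := by
      rcases sq_eq_sq_iff_eq_or_eq_neg.mp h4 with h5 | h5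
      · exact absurd h5 hts.ne
      · exact h5
    subst h5
    nlinarith
  · intro hc
    exact cross_nonneg_of_le hn hm h h' (by linarith)

theorem sign_cross_nonneg_iff {σ n t m s : ℝ} (hσ : σ = 1 ∨ σ = -1) (hn : 0 < n) (hm : 0 < m)
    (h : n ^ 2 + t ^ 2 = 1) (h' : m ^ 2 + s ^ 2 = 1) :
    0 ≤ σ * (m * t - s * n) ↔ 0 ≤ σ * (t - s) := by
  rcases hσ with rfl | rfl
  · simpa using cross_nonneg_iff hn hm h h'
  · have := cross_nonneg_iff hm hn h' h
    constructor <;> intro hh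
    · have := this.mp (by linarith); linarith
    · have := this.mpr (by linarith); linarith

/-! ### Refracted paths across fixed lines: divergence and uniform incidence -/

/-- A polygonal path that crosses the lines `⟪ν i, x⟫ = h i`, refracting there by Snell's law for
the weights `w`, with all lengths at most `L`. -/
structure Trace (ν : ℕ → Plane) (w h : ℕ → ℝ) (p : ℕ) (L : ℝ) (o : Plane) (dir : ℕ → Plane)
    (len : ℕ → ℝ) : Prop where
  norm_normal : ∀ i < p, ‖ν i‖ = 1
  norm_dir : ∀ i ≤ p, ‖dir i‖ = 1
  weight_pos : ∀ i ≤ p, 0 < w i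
  inner_in : ∀ i < p, 0 < (inner ℝ (ν i) (dir i) : ℝ)
  inner_out : ∀ i < p, 0 < (inner ℝ (ν i) (dir (i + 1)) : ℝ)
  snell : ∀ i < p, w i * inner ℝ (rot (ν i)) (dir i) = w (i + 1) * inner ℝ (rot (ν i)) (dir (i + 1))
  line : ∀ i < p, (inner ℝ (ν i) (breakPoint o dir len (i + 1)) : ℝ) = h i
  len_pos : ∀ i < p, 0 < len i
  len_nonneg : ∀ i ≤ p, 0 ≤ len i
  len_le : ∀ i ≤ p, len i ≤ L

namespace Trace

variable {ν : ℕ → Plane} {w h : ℕ → ℝ} {p : ℕ} {L : ℝ} {o : Plane}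
  {dir dir' : ℕ → Plane} {len len' : ℕ → ℝ}

theorem frame_sq_in (R : Trace ν w h p L o dir len) {i : ℕ} (hi : i < p) :
    (inner ℝ (ν i) (dir i) : ℝ) ^ 2 + (inner ℝ (rot (ν i)) (dir i) : ℝ) ^ 2 = 1 :=
  sq_add_sq_frame (R.norm_normal i hi) (R.norm_dir i hi.le)

theorem frame_sq_out (R : Trace ν w h p L o dir len) {i : ℕ} (hi : i < p) :
    (inner ℝ (ν i) (dir (i + 1)) : ℝ) ^ 2 + (inner ℝ (rot (ν i)) (dir (i + 1)) : ℝ) ^ 2 = 1 :=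
  sq_add_sq_frame (R.norm_normal i hi) (R.norm_dir (i + 1) hi)

theorem len_mul_inner (R : Trace ν w h p L o dir len) {i : ℕ} (hi : i < p) :
    len i * inner ℝ (ν i) (dir i) = h i - inner ℝ (ν i) (breakPoint o dir len i) := by
  rw [← R.line i hi, breakPoint, inner_add_right, inner_smul_right]; ring

theorem inner_pred (R : Trace ν w h p L o dir len) {i : ℕ} (hi : i < p) :
    0 < (inner ℝ (ν (i - 1)) (dir i) : ℝ) := by
  cases i with
  | zero => exact R.inner_in 0 hi
  | succ i => exact R.inner_out i (by omega)

/-- Two paths with the same start that cross the same lines keep diverging. -/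
theorem diverge {σ : ℝ} (hσ : σ = 1 ∨ σ = -1) (R : Trace ν w h p L o dir len)
    (R' : Trace ν w h p L o dir' len')
    (h0 : 0 ≤ σ * (inner ℝ (rot (dir 0)) (dir' 0) : ℝ)) :
    ∀ i, i < p → 0 ≤ σ * (inner ℝ (rot (dir i)) (dir' i) : ℝ) ∧
      ∃ y : ℝ, 0 ≤ y ∧ breakPoint o dir' len' i - breakPoint o dir len i =
        (σ * y) • rot (ν (i - 1)) := by
  intro i
  induction i with
  -- For `i = 0` the truncated index `i - 1` is `0`; this is harmless since the displacement
  -- vanishes.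
  | zero => exact fun _ => ⟨h0, 0, le_rfl, by simp [breakPoint]⟩
  | succ i ih =>
    intro hi
    have hi' : i < p := by omega
    obtain ⟨hc, y, hy, hb⟩ := ih hi'
    have hν := R.norm_normal i hi'
    constructor
    -- The sign of the determinant is that of the difference of sines, which Snell's law multiplies
    -- by the positive ratio of the weights.
    · rw [cross_frame hν] at hc ⊢
      rw [sign_cross_nonneg_iff hσ (R'.inner_in i hi') (R.inner_in i hi') (R'.frame_sq_in hi')
        (R.frame_sq_in hi')] at hc
      rw [sign_cross_nonneg_iff hσ (R'.inner_out i hi') (R.inner_out i hi') (R'.frame_sq_out hi')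
        (R.frame_sq_out hi')]
      have h1 := R.snell i hi'
      have h2 := R'.snell i hi'
      have hw := R.weight_pos i hi'.le
      have hw' := R.weight_pos (i + 1) hi'
      refine nonneg_of_mul_nonneg_right ?_ hw'
      have : w (i + 1) * (σ * (inner ℝ (rot (ν i)) (dir' (i + 1)) -
          inner ℝ (rot (ν i)) (dir (i + 1)))) =
          w i * (σ * (inner ℝ (rot (ν i)) (dir' i) - inner ℝ (rot (ν i)) (dir i))) := by
        linear_combination σ * h1 - σ * h2
      rw [this]
      exact mul_nonneg hw.le hc
    · set z : Plane := breakPoint o dir' len' (i + 1) - breakPoint o dir len (i + 1) with hz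
      have hzν : (inner ℝ (ν i) z : ℝ) = 0 := by
        rw [hz, inner_sub_right, R'.line i hi', R.line i hi', sub_self]
      refine ⟨σ * inner ℝ (rot (ν i)) z, ?_, ?_⟩
      -- The determinant of `dir i` and `z` is computed twice: from `z` being parallel to line `i`
      -- (`e1`), and by carrying the displacement over from line `i - 1` (`e3`), where both
      -- contributions have the sign `σ`.
      · refine nonneg_of_mul_nonneg_right ?_ (R.inner_in i hi')
        have e1 : (inner ℝ (rot (dir i)) z : ℝ) =
            inner ℝ (ν i) (dir i) * inner ℝ (rot (ν i)) z := by
          rw [cross_frame hν, hzν]; ring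
        have e2 : z = (σ * y) • rot (ν (i - 1)) + len' i • dir' i - len i • dir i := by
          rw [hz, ← hb]; simp only [breakPoint]; abel
        have e3 : (inner ℝ (rot (dir i)) z : ℝ) = σ * y * inner ℝ (ν (i - 1)) (dir i) +
            len' i * inner ℝ (rot (dir i)) (dir' i) := by
          rw [e2, inner_sub_right, inner_add_right, inner_smul_right, inner_smul_right,
            inner_smul_right, inner_rot_rot, real_inner_comm (dir i) (rot (dir i)), inner_rot_self,
            real_inner_comm (dir i)]
          ring
        have e4 : σ * σ = 1 := by rcases hσ with rfl | rfl <;> norm_num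
        calc (0 : ℝ) ≤ y * inner ℝ (ν (i - 1)) (dir i) +
              len' i * (σ * inner ℝ (rot (dir i)) (dir' i)) :=
              add_nonneg (mul_nonneg hy (R.inner_pred hi').le)
                (mul_nonneg (R'.len_pos i hi').le hc)
          _ = inner ℝ (ν i) (dir i) * (σ * inner ℝ (rot (ν i)) z) := by
              linear_combination σ * e1 - σ * e3 -
                (y * inner ℝ (ν (i - 1)) (dir i)) * e4
      · have e4 : σ * σ = 1 := by rcases hσ with rfl | rfl <;> norm_num
        rw [← mul_assoc, e4, one_mul]
        conv_lhs => rw [eq_frame hν z, hzν, zero_smul, zero_add]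
        rfl

/-- The sign of `s` tells how line `i - 1` leans towards line `i` on the side `σ`. If it leans away
(`s ≤ 0`), a diverging path has at least as far to go to line `i` as `R`, and since its length is at
most `L` it cannot graze that line. If it leans towards it (`s > 0`), a path turned to the side `σ`
and nearly parallel to line `i` would fail to leave line `i - 1` forwards, while one turned to the
other side is no more oblique than `R`. -/
theorem exists_lower_bound_of_sign {σ : ℝ} (hσ : σ = 1 ∨ σ = -1)
    (R : Trace ν w h p L o dir len) {i : ℕ} (hi : i < p) :
    ∃ c : ℝ, 0 < c ∧ ∀ dir' len', Trace ν w h p L o dir' len' →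
      0 ≤ σ * (inner ℝ (rot (dir 0)) (dir' 0) : ℝ) → c ≤ inner ℝ (ν i) (dir' i) := by
  have hL : 0 < L := (R.len_pos i hi).trans_le (R.len_le i hi.le)
  have hn0 := R.inner_in i hi
  have hν := R.norm_normal i hi
  have hν' : ‖ν (i - 1)‖ = 1 := R.norm_normal (i - 1) (by omega)
  set s : ℝ := σ * inner ℝ (ν i) (rot (ν (i - 1))) with hs
  have hσσ : σ * σ = 1 := by rcases hσ with rfl | rfl <;> norm_num
  rcases le_or_gt s 0 with hs0 | hs0
  · refine ⟨len i * inner ℝ (ν i) (dir i) / L, div_pos (mul_pos (R.len_pos i hi) hn0) hL, ?_⟩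
    intro dir' len' R' h0
    obtain ⟨-, y, hy, hb⟩ := R.diverge hσ R' h0 i hi
    rw [div_le_iff₀ hL]
    have h1 := R.len_mul_inner hi
    have h2 := R'.len_mul_inner hi
    have h3 : (inner ℝ (ν i) (breakPoint o dir' len' i) : ℝ) - inner ℝ (ν i) (breakPoint o dir len i)
        = y * s := by
      rw [← inner_sub_right, hb, inner_smul_right, hs]; ring
    have h4 : len' i * inner ℝ (ν i) (dir' i) ≤ L * inner ℝ (ν i) (dir' i) :=
      mul_le_mul_of_nonneg_right (R'.len_le i hi.le) (R'.inner_in i hi).le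
    nlinarith
  · refine ⟨min (inner ℝ (ν i) (dir i)) (s / 2), lt_min hn0 (by linarith), ?_⟩
    intro dir' len' R' h0
    obtain ⟨hc, -⟩ := R.diverge hσ R' h0 i hi
    rw [cross_frame hν, sign_cross_nonneg_iff hσ (R'.inner_in i hi) hn0 (R'.frame_sq_in hi)
      (R.frame_sq_in hi)] at hc
    have f := R.frame_sq_in hi
    have f' := R'.frame_sq_in hi
    have hn' := R'.inner_in i hi
    have hpred := R'.inner_pred hi
    rw [inner_frame hν, inner_rot_left (ν i) (ν (i - 1))] at hpred
    have hle : |(inner ℝ (ν i) (ν (i - 1)) : ℝ)| ≤ 1 := by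
      simpa [hν'] using abs_inner_le hν (ν (i - 1))
    have hsle : s ≤ 1 := by
      have : |(inner ℝ (ν i) (rot (ν (i - 1))) : ℝ)| ≤ 1 := by
        simpa [hν', norm_rot] using abs_inner_le hν (rot (ν (i - 1)))
      rw [abs_le] at this
      rcases hσ with rfl | rfl <;> rw [hs] <;> linarith [this.1, this.2]
    rw [abs_le] at hle
    generalize (inner ℝ (ν i) (dir' i) : ℝ) = n at *
    generalize (inner ℝ (ν i) (dir i) : ℝ) = m at *
    generalize (inner ℝ (rot (ν i)) (dir' i) : ℝ) = t at *
    generalize (inner ℝ (rot (ν i)) (dir i) : ℝ) = t₀ at *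
    generalize (inner ℝ (ν i) (ν (i - 1)) : ℝ) = a at *
    generalize (inner ℝ (ν i) (rot (ν (i - 1))) : ℝ) = b at *
    have hb2 : b * t = s * (σ * t) := by rw [hs]; linear_combination (-(b * t)) * hσσ
    have ht2 : (σ * t) ^ 2 = t ^ 2 := by rw [mul_pow, sq σ, hσσ, one_mul]
    have ht2' : (σ * t₀) ^ 2 = t₀ ^ 2 := by rw [mul_pow, sq σ, hσσ, one_mul]
    rw [mul_sub] at hc
    generalize σ * t = x at *
    generalize σ * t₀ = x₀ at *
    rcases le_or_gt x 0 with hx | hx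
    · refine (min_le_left _ _).trans ?_
      refine le_of_sq_le_sq ?_ hn'.le
      nlinarith
    · refine (min_le_right _ _).trans ?_
      -- `hpred` now says `s * x < a * n`, and `a ≤ 1`. If `n < s / 2`, then `n` and `x` are both
      -- below `1 / 2`, against `n ^ 2 + x ^ 2 = 1`.
      have hsx : s * x < n := by nlinarith
      by_contra hlt
      push Not at hlt
      have hx2 : x < 1 / 2 := by
        by_contra hge
        push Not at hge
        nlinarith
      nlinarith

/-- The angles of incidence of the paths crossing given lines are bounded away from `π / 2`. -/
theorem exists_lower_bound (R : Trace ν w h p L o dir len) {i : ℕ} (hi : i < p) :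
    ∃ c : ℝ, 0 < c ∧ ∀ dir' len', Trace ν w h p L o dir' len' → c ≤ inner ℝ (ν i) (dir' i) := by
  obtain ⟨c, hc, h1⟩ := R.exists_lower_bound_of_sign (Or.inl rfl) hi
  obtain ⟨c', hc', h2⟩ := R.exists_lower_bound_of_sign (Or.inr rfl) hi
  refine ⟨min c c', lt_min hc hc', fun dir' len' R' => ?_⟩
  rcases le_total 0 (inner ℝ (rot (dir 0)) (dir' 0) : ℝ) with h0 | h0
  · exact (min_le_left _ _).trans (h1 dir' len' R' (by linarith))
  · exact (min_le_right _ _).trans (h2 dir' len' R' (by linarith))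

theorem len_zero_mul_inner_eq (R : Trace ν w h p L o dir len) (R' : Trace ν w h p L o dir' len')
    (hp : 0 < p) :
    len 0 * inner ℝ (ν 0) (dir 0) = len' 0 * (inner ℝ (ν 0) (dir' 0) : ℝ) := by
  rw [R.len_mul_inner hp, R'.len_mul_inner hp]; rfl

/-- Any one path serves as the reference for all others. The bound on `len 0` holds because `len 0`
is at least the distance from `o` to the first line. -/
theorem exists_uniform_lower_bound (ν : ℕ → Plane) (w h : ℕ → ℝ) (p : ℕ) (L : ℝ) (o : Plane) :
    ∃ c : ℝ, 0 < c ∧ ∀ dir len, Trace ν w h p L o dir len →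
      (∀ i < p, c ≤ inner ℝ (ν i) (dir i)) ∧ (0 < p → c ≤ len 0) := by
  by_cases hex : ∃ dir len, Trace ν w h p L o dir len
  · obtain ⟨dir, len, R⟩ := hex
    have hev : ∀ᶠ c in 𝓝[>] (0 : ℝ), ∀ i ∈ Finset.range p, ∀ dir' len',
        Trace ν w h p L o dir' len' → c ≤ inner ℝ (ν i) (dir' i) := by
      rw [Filter.eventually_all_finset]
      intro i hi
      obtain ⟨c, hc, hle⟩ := R.exists_lower_bound (Finset.mem_range.mp hi)
      filter_upwards [Ioc_mem_nhdsGT hc] with c' hc' dir' len' R'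
      exact hc'.2.trans (hle dir' len' R')
    have hev' : ∀ᶠ c in 𝓝[>] (0 : ℝ), 0 < p → ∀ dir' len',
        Trace ν w h p L o dir' len' → c ≤ len' 0 := by
      rw [Filter.eventually_imp_distrib_left]
      intro hp
      have hpos : 0 < len 0 * inner ℝ (ν 0) (dir 0) := mul_pos (R.len_pos 0 hp) (R.inner_in 0 hp)
      filter_upwards [Ioc_mem_nhdsGT hpos] with c' hc' dir' len' R'
      refine hc'.2.trans ?_
      rw [R.len_zero_mul_inner_eq R' hp]
      refine mul_le_of_le_one_right (R'.len_pos 0 hp).le ((le_abs_self _).trans ?_)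
      simpa [R'.norm_dir 0 (Nat.zero_le _)] using abs_inner_le (R'.norm_normal 0 hp) (dir' 0)
    obtain ⟨c, ⟨h1, h2⟩, hc⟩ := ((hev.and hev').and self_mem_nhdsWithin).exists
    exact ⟨c, hc, fun dir' len' R' =>
      ⟨fun i hi => h1 i (Finset.mem_range.mpr hi) dir' len' R', fun hp => h2 hp dir' len' R'⟩⟩
  · exact ⟨1, one_pos, fun dir len R => absurd ⟨dir, len, R⟩ hex⟩

/-! ### Rigidity and quantitative stability of refracted paths -/

/-- A path is determined by its start and its last direction. -/
theorem eq_of_dir_last (R : Trace ν w h p L o dir len) (R' : Trace ν w h p L o dir' len')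
    (hlast : dir p = dir' p) : ∀ i ≤ p, dir i = dir' i := by
  intro i hi
  induction hi using Nat.decreasingInduction with
  | self => exact hlast
  | of_succ i hi ih =>
    have hν := R.norm_normal i hi
    have ht : (inner ℝ (rot (ν i)) (dir i) : ℝ) = inner ℝ (rot (ν i)) (dir' i) := by
      refine mul_left_cancel₀ (R.weight_pos i hi.le).ne' ?_
      rw [R.snell i hi, R'.snell i hi, ih]
    have hn : (inner ℝ (ν i) (dir i) : ℝ) = inner ℝ (ν i) (dir' i) := by
      refine (sq_eq_sq₀ (R.inner_in i hi).le (R'.inner_in i hi).le).mp ?_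
      have h1 := R.frame_sq_in hi
      have h2 := R'.frame_sq_in hi
      rw [ht] at h1
      linarith
    rw [eq_frame hν (dir i), eq_frame hν (dir' i), ht, hn]

theorem breakPoint_eq (R : Trace ν w h p L o dir len) (R' : Trace ν w h p L o dir' len')
    (hdir : ∀ i ≤ p, dir i = dir' i) :
    ∀ i ≤ p, breakPoint o dir len i = breakPoint o dir' len' i := by
  intro i
  induction i with
  | zero => exact fun _ => rfl
  | succ i ih =>
    intro hi
    have hb := ih (by omega)
    have hlen : len i = len' i := by
      refine mul_right_cancel₀ (R.inner_in i hi).ne' ?_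
      rw [R.len_mul_inner hi, hdir i (by omega), R'.len_mul_inner hi, hb]
    simp only [breakPoint]
    rw [hb, hlen, hdir i (by omega)]

/-- By Snell's law the tangential components differ by at most `m` times the old difference. For the
normal ones, `n ^ 2 + t ^ 2 = 1` gives `|n - n'| * (n + n') = |t - t'| * |t + t'|`, and `n + n' ≥ 2
* κ` costs the factor `1 / κ`. -/
theorem norm_dir_sub_succ_le (R : Trace ν w h p L o dir len) (R' : Trace ν w h p L o dir' len')
    {i : ℕ} (hi : i < p) {m κ : ℝ} (hm : w i ≤ m * w (i + 1)) (hκ : 0 < κ)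
    (hκ1 : κ ≤ 1) (hn : κ ≤ inner ℝ (ν i) (dir (i + 1))) (hn' : κ ≤ inner ℝ (ν i) (dir' (i + 1))) :
    κ * ‖dir (i + 1) - dir' (i + 1)‖ ≤ 2 * m * ‖dir i - dir' i‖ := by
  have hν := R.norm_normal i hi
  have hw := R.weight_pos (i + 1) hi
  have h1 := R.snell i hi
  have h2 := R'.snell i hi
  have f1 := R.frame_sq_out hi
  have f2 := R'.frame_sq_out hi
  have hA := abs_inner_le (ν := rot (ν i)) (by rw [norm_rot, hν]) (dir i - dir' i)
  have hB := norm_le_frame hν (dir (i + 1) - dir' (i + 1))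
  rw [inner_sub_right] at hA
  rw [inner_sub_right, inner_sub_right] at hB
  have hle : |(inner ℝ (rot (ν i)) (dir (i + 1)) : ℝ)| ≤ 1 := by
    rw [← sq_le_one_iff_abs_le_one]; nlinarith
  have hle' : |(inner ℝ (rot (ν i)) (dir' (i + 1)) : ℝ)| ≤ 1 := by
    rw [← sq_le_one_iff_abs_le_one]; nlinarith
  have hΔ : |(inner ℝ (rot (ν i)) (dir (i + 1)) : ℝ) - inner ℝ (rot (ν i)) (dir' (i + 1))| ≤
      m * ‖dir i - dir' i‖ := by
    refine le_of_mul_le_mul_left ?_ hw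
    rw [← abs_of_pos hw, ← abs_mul, abs_of_pos hw, mul_sub, ← h1, ← h2, ← mul_sub, abs_mul,
      abs_of_pos (R.weight_pos i hi.le)]
    calc w i * _ ≤ m * w (i + 1) * ‖dir i - dir' i‖ :=
          mul_le_mul hm hA (abs_nonneg _) ((R.weight_pos i hi.le).le.trans hm)
      _ = _ := by ring
  generalize (inner ℝ (ν i) (dir (i + 1)) : ℝ) = n at *
  generalize (inner ℝ (ν i) (dir' (i + 1)) : ℝ) = n' at *
  generalize (inner ℝ (rot (ν i)) (dir (i + 1)) : ℝ) = t at *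
  generalize (inner ℝ (rot (ν i)) (dir' (i + 1)) : ℝ) = t' at *
  have hN : κ * |n - n'| ≤ |t - t'| := by
    have e : |n - n'| * (n + n') = |t - t'| * |t + t'| := by
      rw [← abs_mul, ← abs_of_pos (show 0 < n + n' by linarith), ← abs_mul,
        show (n - n') * (n + n') = -((t - t') * (t + t')) by linear_combination f1 - f2, abs_neg]
    have h2 : |t + t'| ≤ 2 := (abs_add_le _ _).trans (by linarith)
    nlinarith [abs_nonneg (n - n'), abs_nonneg (t - t')]
  nlinarith [abs_nonneg (t - t')]

/-- A segment's length is the distance of its start to the next line divided by the normal component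
of its direction; `c` keeps this division under control. -/
theorem abs_len_sub_le (R : Trace ν w h p L o dir len) (R' : Trace ν w h p L o dir' len')
    {i : ℕ} (hi : i < p) {c : ℝ} (hn : c ≤ inner ℝ (ν i) (dir i)) :
    c * |len i - len' i| ≤
      ‖breakPoint o dir len i - breakPoint o dir' len' i‖ + L * ‖dir i - dir' i‖ := by
  have hν := R.norm_normal i hi
  have h1 := R.len_mul_inner hi
  have h2 := R'.len_mul_inner hi
  have hA := abs_inner_le hν (dir i - dir' i)
  have hB := abs_inner_le hν (breakPoint o dir len i - breakPoint o dir' len' i)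
  have hl' := R'.len_pos i hi
  have hlL := R'.len_le i hi.le
  rw [inner_sub_right] at hA hB
  have e : |len i - len' i| * inner ℝ (ν i) (dir i) =
      |-((inner ℝ (ν i) (breakPoint o dir len i) : ℝ) -
        inner ℝ (ν i) (breakPoint o dir' len' i)) +
        -(len' i * (inner ℝ (ν i) (dir i) - inner ℝ (ν i) (dir' i)))| := by
    rw [← abs_of_pos (R.inner_in i hi), ← abs_mul, abs_of_pos (R.inner_in i hi)]
    congr 1
    linear_combination h1 - h2
  calc c * |len i - len' i| ≤ |len i - len' i| * inner ℝ (ν i) (dir i) := by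
        rw [mul_comm]; exact mul_le_mul_of_nonneg_left hn (abs_nonneg _)
    _ ≤ _ := by
      rw [e]
      refine (abs_add_le _ _).trans ?_
      rw [abs_neg, abs_neg, abs_mul, abs_of_pos hl']
      exact add_le_add hB (mul_le_mul hlL hA (abs_nonneg _) (hl'.le.trans hlL))

theorem norm_breakPoint_sub_succ_le (R : Trace ν w h p L o dir len)
    (R' : Trace ν w h p L o dir' len') {i : ℕ} (hi : i ≤ p) :
    ‖breakPoint o dir len (i + 1) - breakPoint o dir' len' (i + 1)‖ ≤
      ‖breakPoint o dir len i - breakPoint o dir' len' i‖ + |len i - len' i| +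
        L * ‖dir i - dir' i‖ := by
  have e : breakPoint o dir len (i + 1) - breakPoint o dir' len' (i + 1) =
      (breakPoint o dir len i - breakPoint o dir' len' i) + (len i - len' i) • dir i +
        len' i • (dir i - dir' i) := by
    simp only [breakPoint, sub_smul, smul_sub]; abel
  rw [e]
  refine (norm_add₃_le).trans ?_
  rw [norm_smul, norm_smul, R.norm_dir i hi, Real.norm_eq_abs, Real.norm_eq_abs, mul_one,
    abs_of_nonneg (R'.len_nonneg i hi)]
  gcongr
  exact R'.len_le i hi

/-- Distance of two paths at their `i`-th break point, as position and direction. -/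
noncomputable def gap (o : Plane) (dir dir' : ℕ → Plane) (len len' : ℕ → ℝ) (i : ℕ) : ℝ :=
  ‖dir i - dir' i‖ + ‖breakPoint o dir len i - breakPoint o dir' len' i‖

theorem gap_nonneg (i : ℕ) : 0 ≤ gap o dir dir' len len' i :=
  add_nonneg (norm_nonneg _) (norm_nonneg _)

theorem abs_len_sub_le_gap (R : Trace ν w h p L o dir len) (R' : Trace ν w h p L o dir' len')
    {i : ℕ} (hi : i < p) {c : ℝ} (hc : 0 < c) (hn : c ≤ inner ℝ (ν i) (dir i)) :
    |len i - len' i| ≤ (1 + L) / c * gap o dir dir' len len' i := by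
  have h1 := R.abs_len_sub_le R' hi hn
  have hL : 0 ≤ L := (R.len_nonneg i hi.le).trans (R.len_le i hi.le)
  rw [div_mul_eq_mul_div, le_div_iff₀ hc, mul_comm _ c]
  refine h1.trans ?_
  unfold gap
  nlinarith [norm_nonneg (dir i - dir' i),
    norm_nonneg (breakPoint o dir len i - breakPoint o dir' len' i)]

/-- The factor `g` records the possible obliqueness after refraction: it will be `ε` on entering a
lighter triangle and `1` otherwise. Keeping it on the left leaves a constant on the right that is
independent of `ε`. -/
theorem gap_succ_le (R : Trace ν w h p L o dir len) (R' : Trace ν w h p L o dir' len')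
    {i : ℕ} (hi : i < p) {c m g : ℝ} (hc : 0 < c) (hc1 : c ≤ 1) (hg : 0 < g) (hg1 : g ≤ 1)
    (hm : w i ≤ m * w (i + 1)) (hn : c ≤ inner ℝ (ν i) (dir i))
    (ho : c * g ≤ inner ℝ (ν i) (dir (i + 1))) (ho' : c * g ≤ inner ℝ (ν i) (dir' (i + 1))) :
    g * gap o dir dir' len len' (i + 1) ≤
      (2 * m / c + (1 + (1 + L) / c + L)) * gap o dir dir' len len' i := by
  have hL : 0 ≤ L := (R.len_nonneg i hi.le).trans (R.len_le i hi.le)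
  have h1 := R.norm_dir_sub_succ_le R' hi hm (mul_pos hc hg)
    (mul_le_one₀ hc1 hg.le hg1) ho ho'
  have h2 := R.norm_breakPoint_sub_succ_le R' hi.le
  have h3 := R.abs_len_sub_le_gap R' hi hc hn
  have hm0 : 0 ≤ m := by
    by_contra hneg
    push Not at hneg
    nlinarith [R.weight_pos i hi.le, R.weight_pos (i + 1) hi]
  have hd : ‖dir i - dir' i‖ ≤ gap o dir dir' len len' i := by
    unfold gap; linarith [norm_nonneg (breakPoint o dir len i - breakPoint o dir' len' i)]
  have hb : ‖breakPoint o dir len i - breakPoint o dir' len' i‖ ≤ gap o dir dir' len len' i := by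
    unfold gap; linarith [norm_nonneg (dir i - dir' i)]
  have h4 : g * ‖dir (i + 1) - dir' (i + 1)‖ ≤ 2 * m / c * gap o dir dir' len len' i := by
    rw [div_mul_eq_mul_div, le_div_iff₀ hc]
    calc _ = c * g * ‖dir (i + 1) - dir' (i + 1)‖ := by ring
      _ ≤ _ := h1
      _ ≤ _ := by gcongr
  have h5 : g * ‖breakPoint o dir len (i + 1) - breakPoint o dir' len' (i + 1)‖ ≤
      (1 + (1 + L) / c + L) * gap o dir dir' len len' i := by
    refine (mul_le_of_le_one_left (norm_nonneg _) hg1).trans (h2.trans ?_)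
    have : L * ‖dir i - dir' i‖ ≤ L * gap o dir dir' len len' i := by gcongr
    linarith
  have : gap o dir dir' len len' (i + 1) = ‖dir (i + 1) - dir' (i + 1)‖ +
    ‖breakPoint o dir len (i + 1) - breakPoint o dir' len' (i + 1)‖ := rfl
  rw [this, mul_add, add_mul]
  exact add_le_add h4 h5

end Trace

theorem norm_sub_le_angle_of_norm_eq_one {x y : Plane} (hx : ‖x‖ = 1) (hy : ‖y‖ = 1) :
    ‖x - y‖ ≤ InnerProductGeometry.angle x y := by
  refine le_of_sq_le_sq ?_ (InnerProductGeometry.angle_nonneg x y)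
  have h1 := InnerProductGeometry.cos_angle_mul_norm_mul_norm x y
  have h2 := Real.one_sub_sq_div_two_le_cos (x := InnerProductGeometry.angle x y)
  rw [norm_sub_sq_real, hx, hy, ← h1, hx, hy]
  linarith

/-! ### Counting triangles and entries into lighter triangles -/

/-- Two vertices and a third one of an affinely independent triple span a nonzero area. -/
theorem cross_ne_zero_of_affineIndependent {s : Finset Plane}
    (hs : AffineIndependent ℝ ((↑) : s → Plane)) {a b c : Plane} (ha : a ∈ s) (hb : b ∈ s)
    (hc : c ∈ s) (hab : a ≠ b) (hac : a ≠ c) (hbc : b ≠ c) :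
    (inner ℝ (rot (b - a)) (c - a) : ℝ) ≠ 0 := by
  intro h0
  have hinj : Function.Injective ![(⟨a, ha⟩ : s), ⟨b, hb⟩, ⟨c, hc⟩] := by
    intro i j hij
    fin_cases i <;> fin_cases j <;> simp_all
  have hind := (hs.comp_embedding ⟨_, hinj⟩)
  rw [affineIndependent_iff] at hind
  simp only [inner_coord, rot_zero_coord, rot_one_coord, PiLp.sub_apply] at h0
  have key : ∀ j : Fin 2, b j - a j = 0 := by
    intro j
    -- These weights sum to zero and combine the points to `(c j - a j) • (b - a) - (b j - a j) • (c
    -- - a)`, whose coordinates are `0` or, up to sign, the determinant.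
    have := hind Finset.univ ![(b j - a j) - (c j - a j), c j - a j, -(b j - a j)]
      (by simp [Fin.sum_univ_three])
      (by
        ext i
        fin_cases j <;> fin_cases i <;> simp [Fin.sum_univ_three] <;> first | linear_combination h0 | linear_combination -h0 | ring)
      2 (Finset.mem_univ _)
    exact neg_eq_zero.mp (by simpa using this)
  apply hab
  ext j
  linarith [key j]

/-- Two triangles of a simplicial complex on the same side of a common edge coincide. -/
theorem eq_of_same_side {K : Geometry.SimplicialComplex ℝ Plane} {f g : Finset Plane}
    (hf : f ∈ K.faces) (hg : g ∈ K.faces) (hf3 : f.card = 3) (hg3 : g.card = 3)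
    {a b c d : Plane} (haf : a ∈ f) (hbf : b ∈ f) (hcf : c ∈ f) (hag : a ∈ g) (hbg : b ∈ g)
    (hdg : d ∈ g) (hab : a ≠ b) (hc : 0 < (inner ℝ (rot (b - a)) (c - a) : ℝ))
    (hd : 0 < (inner ℝ (rot (b - a)) (d - a) : ℝ)) : f = g := by
  by_contra hne
  have hfg : (f : Set Plane) ∩ g ⊆ {x | (inner ℝ (rot (b - a)) (x - a) : ℝ) = 0} := by
    have hcard : (f ∩ g).card ≤ 2 := by
      by_contra hlt
      push Not at hlt
      have h1 : f ∩ g = f := Finset.eq_of_subset_of_card_le Finset.inter_subset_left (by omega)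
      have h2 : f ∩ g = g := Finset.eq_of_subset_of_card_le Finset.inter_subset_right (by omega)
      exact hne (h1.symm.trans h2)
    have hpair : ({a, b} : Finset Plane) = f ∩ g := by
      refine Finset.eq_of_subset_of_card_le ?_ (by rwa [Finset.card_pair hab])
      intro x hx
      rw [Finset.mem_insert, Finset.mem_singleton] at hx
      rcases hx with rfl | rfl <;> simp [*]
    intro x hx
    have : x ∈ ({a, b} : Finset Plane) := by rw [hpair]; exact Finset.mem_inter.mpr hx
    rw [Finset.mem_insert, Finset.mem_singleton] at this
    rcases this with rfl | rfl
    · simp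
    · show (inner ℝ (rot (x - a)) (x - a) : ℝ) = 0
      rw [real_inner_comm, inner_rot_self]
  have hconv : convexHull ℝ (f : Set Plane) ∩ convexHull ℝ (g : Set Plane) ⊆
      {x | (inner ℝ (rot (b - a)) (x - a) : ℝ) = 0} := by
    refine (K.inter_subset_convexHull hf hg).trans (convexHull_min hfg ?_)
    intro x hx y hy s t hs ht hst
    simp only [Set.mem_ofPred_eq, inner_sub_right] at hx hy ⊢
    rw [inner_add_right, inner_smul_right, inner_smul_right]
    linear_combination s * hx + t * hy + (inner ℝ (rot (b - a)) a) * hst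
  set C : ℝ := inner ℝ (rot (b - a)) (c - a) with hC
  set D : ℝ := inner ℝ (rot (b - a)) (d - a) with hD
  set A : ℝ := inner ℝ (rot (d - a)) (c - a) / C with hA
  set G : ℝ := D / C with hG
  have hGpos : 0 < G := div_pos hd hc
  -- Barycentric coordinates of `d` in `a, b, c`, by Cramer's rule; the coefficient of `c` is
  -- positive because `c` and `d` lie on the same side.
  have hexp : d = (1 - A - G) • a + A • b + G • c := by
    have e1 : A * C = inner ℝ (rot (d - a)) (c - a) := div_mul_cancel₀ _ hc.ne'
    have e2 : G * C = D := div_mul_cancel₀ _ hc.ne'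
    rw [hC, inner_coord] at e1 e2
    rw [inner_coord] at e1
    rw [hD, inner_coord] at e2
    simp only [rot_zero_coord, rot_one_coord, PiLp.sub_apply] at e1 e2
    have hC' := hc.ne'
    rw [hC, inner_coord] at hC'
    simp only [rot_zero_coord, rot_one_coord, PiLp.sub_apply] at hC'
    ext j
    refine mul_left_cancel₀ hC' ?_
    fin_cases j
    · simp only [PiLp.add_apply, PiLp.smul_apply, smul_eq_mul, Fin.zero_eta]
      linear_combination (-(b 0 - a 0)) * e1 - (c 0 - a 0) * e2
    · simp only [PiLp.add_apply, PiLp.smul_apply, smul_eq_mul, Fin.mk_one]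
      linear_combination (-(b 1 - a 1)) * e1 - (c 1 - a 1) * e2
  -- A point slightly off the midpoint of `a b` towards `d` lies in both triangles but not on the
  -- line `a b`, while distinct triangles of the complex sharing `a, b` meet only in that line.
  have hev : ∀ᶠ t in 𝓝[>] (0 : ℝ), 0 ≤ (1 - t) / 2 ∧ 0 ≤ (1 - t) / 2 + t * (1 - A - G) ∧
      0 ≤ (1 - t) / 2 + t * A := by
    have h : ∀ B : ℝ, ∀ᶠ t in 𝓝[>] (0 : ℝ), 0 ≤ (1 - t) / 2 + t * B := by
      intro B
      have ht : Tendsto (fun t : ℝ => (1 - t) / 2 + t * B) (𝓝[>] 0) (𝓝 ((1 - 0) / 2 + 0 * B)) :=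
        (Continuous.tendsto (by fun_prop) 0).mono_left nhdsWithin_le_nhds
      filter_upwards [ht.eventually_const_lt (show (0 : ℝ) < (1 - 0) / 2 + 0 * B by norm_num)]
        with t ht using ht.le
    filter_upwards [h 0, h (1 - A - G), h A] with t h1 h2 h3
    exact ⟨by linarith, h2, h3⟩
  obtain ⟨t, ⟨h1, h2, h3⟩, ht⟩ := (hev.and self_mem_nhdsWithin).exists
  have ht0 : 0 < t := ht
  have conv3 : ∀ (s : Finset Plane) (x y z : Plane) (α β γ : ℝ), x ∈ s → y ∈ s → z ∈ s →
      0 ≤ α → 0 ≤ β → 0 ≤ γ → α + β + γ = 1 →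
      α • x + β • y + γ • z ∈ convexHull ℝ (s : Set Plane) := by
    intro s x y z α β γ hx hy hz hα hβ hγ hsum
    have := (convex_convexHull ℝ (s : Set Plane)).sum_mem (t := Finset.univ) (w := ![α, β, γ])
      (z := ![x, y, z]) (by intro i _; fin_cases i <;> simpa) (by simpa [Fin.sum_univ_three])
      (by intro i _; fin_cases i <;> exact subset_convexHull ℝ _ (by simpa))
    simpa [Fin.sum_univ_three] using this
  have hxg : ((1 - t) / 2) • a + ((1 - t) / 2) • b + t • d ∈ convexHull ℝ (g : Set Plane) :=
    conv3 g a b d _ _ _ hag hbg hdg h1 h1 ht0.le (by ring)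
  have hxf : ((1 - t) / 2) • a + ((1 - t) / 2) • b + t • d ∈ convexHull ℝ (f : Set Plane) := by
    have := conv3 f a b c ((1 - t) / 2 + t * (1 - A - G)) ((1 - t) / 2 + t * A) (t * G) haf hbf hcf
      h2 h3 (mul_nonneg ht0.le hGpos.le) (by ring)
    rw [show ((1 - t) / 2) • a + ((1 - t) / 2) • b + t • d =
      ((1 - t) / 2 + t * (1 - A - G)) • a + ((1 - t) / 2 + t * A) • b + (t * G) • c by
        conv_lhs => rw [hexp]
        module]
    exact this
  have h0 := hconv ⟨hxf, hxg⟩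
  have hval : (inner ℝ (rot (b - a)) (((1 - t) / 2) • a + ((1 - t) / 2) • b + t • d - a) : ℝ) =
      t * D := by
    rw [show ((1 - t) / 2) • a + ((1 - t) / 2) • b + t • d - a =
      ((1 - t) / 2) • (b - a) + t • (d - a) by module, inner_add_right, inner_smul_right,
      inner_smul_right, real_inner_comm (b - a), inner_rot_self, mul_zero, zero_add]
  rw [Set.mem_ofPred_eq, hval] at h0
  exact (mul_pos ht0 hd).ne' h0

namespace WeightedTriangulation

variable (T : WeightedTriangulation)

theorem vertices_eq_biUnion : T.K.vertices = ⋃ f ∈ T.triangles, (f : Set Plane) := by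
  ext x
  simp only [Set.mem_iUnion, Finset.mem_coe, exists_prop]
  constructor
  · intro hx
    obtain ⟨f, hf, hxf⟩ := T.pure _ hx
    exact ⟨f, hf, hxf (Finset.mem_singleton_self x)⟩
  · rintro ⟨f, hf, hxf⟩
    exact T.K.down_closed ((T.mem_triangles f).mp hf).1 (Finset.singleton_subset_iff.mpr hxf)
      (Finset.singleton_nonempty x)

theorem finite_vertices : T.K.vertices.Finite := by
  rw [T.vertices_eq_biUnion]
  exact T.triangles.finite_toSet.biUnion fun f _ => f.finite_toSet

/-- To each triangle corresponds an ordered pair of its vertices with the third one on the left. By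
`eq_of_same_side` this is injective into the ordered pairs of vertices. -/
theorem card_triangles_le : T.triangles.card ≤ T.n ^ 2 := by
  classical
  have hex : ∀ f ∈ T.triangles, ∃ e : Plane × Plane, e.1 ∈ f ∧ e.2 ∈ f ∧ e.1 ≠ e.2 ∧
      ∃ c ∈ f, 0 < (inner ℝ (rot (e.2 - e.1)) (c - e.1) : ℝ) := by
    intro f hf
    obtain ⟨hfK, hf3⟩ := (T.mem_triangles f).mp hf
    obtain ⟨a, b, c, hab, hac, hbc, rfl⟩ := Finset.card_eq_three.mp hf3
    have hne := cross_ne_zero_of_affineIndependent (T.K.indep hfK) (a := a) (b := b) (c := c)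
      (by simp) (by simp) (by simp) hab hac hbc
    rcases hne.lt_or_gt with h | h
    · refine ⟨(b, a), by simp, by simp, hab.symm, c, by simp, ?_⟩
      simp only [inner_coord, rot_zero_coord, rot_one_coord, PiLp.sub_apply] at h ⊢
      linarith
    · exact ⟨(a, b), by simp, by simp, hab, c, by simp, h⟩
  choose! e he1 he2 hne he3 using hex
  have hV : ∀ f ∈ T.triangles, ∀ x ∈ f, x ∈ T.finite_vertices.toFinset := by
    intro f hf x hx
    rw [Set.Finite.mem_toFinset, T.vertices_eq_biUnion]
    exact Set.mem_biUnion hf hx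
  have hle : T.triangles.card ≤
      (T.finite_vertices.toFinset ×ˢ T.finite_vertices.toFinset).card := by
    refine Finset.card_le_card_of_injOn e (fun f hf => ?_) (fun f hf g hg hfg => ?_)
    · exact Finset.mem_coe.mpr (Finset.mem_product.mpr
        ⟨hV f hf _ (he1 f hf), hV f hf _ (he2 f hf)⟩)
    · obtain ⟨c, hc, hc0⟩ := he3 f hf
      obtain ⟨d, hd, hd0⟩ := he3 g hg
      have hf' := (T.mem_triangles f).mp hf
      have hg' := (T.mem_triangles g).mp hg
      rw [← hfg] at hd0
      exact eq_of_same_side hf'.1 hg'.1 hf'.2 hg'.2 (he1 f hf) (he2 f hf) hc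
        (hfg ▸ he1 g hg) (hfg ▸ he2 g hg) hd (hne f hf) hc0 hd0
  rw [Finset.card_product, ← sq, ← Set.ncard_eq_toFinset_card _ T.finite_vertices] at hle
  exact hle

/-- A sequence of at most `n ^ 2` crossings does not lead to a lighter triangle every time. -/
theorem card_lighter_lt {p : ℕ} {face : ℕ → Finset Plane} (hface : ∀ i ≤ p, face i ∈ T.triangles)
    (hp : p ≤ T.n ^ 2) :
    ((Finset.range p).filter
      fun i => T.weight (face (i + 1)) < T.weight (face i)).card < T.n ^ 2 := by
  have hpos : 0 < T.n ^ 2 :=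
    (Finset.card_pos.mpr T.nonempty).trans_le T.card_triangles_le
  by_contra hge
  push Not at hge
  have hle : ((Finset.range p).filter
      fun i => T.weight (face (i + 1)) < T.weight (face i)).card ≤ p :=
    (Finset.card_filter_le _ _).trans (Finset.card_range p).le
  have hall : ∀ i < p, T.weight (face (i + 1)) < T.weight (face i) := by
    have : (Finset.range p).filter (fun i => T.weight (face (i + 1)) < T.weight (face i)) =
        Finset.range p :=
      Finset.eq_of_subset_of_card_le (Finset.filter_subset _ _) (by rw [Finset.card_range]; omega)
    rw [Finset.filter_eq_self] at this
    exact fun i hi => this i (Finset.mem_range.mpr hi)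
  have hanti : ∀ i j, i < j → j ≤ p → T.weight (face j) < T.weight (face i) := by
    intro i j hij
    induction j, hij using Nat.le_induction with
    | base => exact fun h => hall i h
    | succ j hj ih => exact fun h => (hall j h).trans (ih (by omega))
  -- Strict descent at every crossing makes the `p + 1` triangles distinct; here `p = n ^ 2`, one
  -- triangle too many.
  have hcard : (Finset.range (p + 1)).card ≤ T.triangles.card := by
    refine Finset.card_le_card_of_injOn face (fun i hi => ?_) (fun i hi j hj hij => ?_)
    · exact hface i (by simpa [Nat.lt_succ_iff] using hi)
    · have hi' : i ≤ p := by simpa [Nat.lt_succ_iff] using hi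
      have hj' : j ≤ p := by simpa [Nat.lt_succ_iff] using hj
      rcases lt_trichotomy i j with h | h | h
      · exact absurd (congrArg T.weight hij) (hanti i j h hj').ne'
      · exact h
      · exact absurd (congrArg T.weight hij) (hanti j i h hi').ne
  rw [Finset.card_range] at hcard
  have := T.card_triangles_le
  omega

end WeightedTriangulation

/-! ### Iterating the gap estimate and comparing points at equal cost -/

namespace Trace

variable {ν : ℕ → Plane} {w h : ℕ → ℝ} {p : ℕ} {L : ℝ} {o : Plane}
  {dir dir' : ℕ → Plane} {len len' : ℕ → ℝ}

theorem prod_mul_gap_le {K : ℝ} {g : ℕ → ℝ} (hK : 0 ≤ K) (hg : ∀ i < p, 0 ≤ g i)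
    (hstep : ∀ i < p, g i * gap o dir dir' len len' (i + 1) ≤ K * gap o dir dir' len len' i) :
    ∀ i ≤ p, (∏ j ∈ Finset.range i, g j) * gap o dir dir' len len' i ≤
      K ^ i * gap o dir dir' len len' 0 := by
  intro i
  induction i with
  | zero => simp
  | succ i ih =>
    intro hi
    have h0 : 0 ≤ ∏ j ∈ Finset.range i, g j :=
      Finset.prod_nonneg fun j hj => hg j (by have := Finset.mem_range.mp hj; omega)
    rw [Finset.prod_range_succ, mul_assoc]
    calc _ ≤ (∏ j ∈ Finset.range i, g j) * (K * gap o dir dir' len len' i) :=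
          mul_le_mul_of_nonneg_left (hstep i hi) h0
      _ = K * ((∏ j ∈ Finset.range i, g j) * gap o dir dir' len len' i) := by ring
      _ ≤ K * (K ^ i * gap o dir dir' len len' 0) :=
          mul_le_mul_of_nonneg_left (ih (by omega)) hK
      _ = _ := by ring

/-- Length is at most weighted length divided by the least weight. -/
theorem mul_norm_sub_le (R : Trace ν w h p L o dir len) {m : ℝ} (hw : ∀ i ≤ p, m ≤ w i) {j k : ℕ}
    (hjk : j ≤ k) (hk : k ≤ p) {s : ℝ} (hs : 0 ≤ s) :
    m * ‖breakPoint o dir len k + s • dir k - breakPoint o dir len j‖ ≤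
      ∑ i ∈ Finset.range k, w i * len i + w k * s - ∑ i ∈ Finset.range j, w i * len i := by
  have hstep : ∀ k s, k ≤ p → 0 ≤ s → m * ‖s • dir k‖ ≤ w k * s := by
    intro k s hk hs
    rw [norm_smul, R.norm_dir k hk, mul_one, Real.norm_eq_abs, abs_of_nonneg hs]
    exact mul_le_mul_of_nonneg_right (hw k hk) hs
  have hm : m * ‖breakPoint o dir len k - breakPoint o dir len j‖ ≤
      ∑ i ∈ Finset.range k, w i * len i - ∑ i ∈ Finset.range j, w i * len i := by
    induction k, hjk using Nat.le_induction with
    | base => simp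
    | succ k hjk ih =>
      have h1 := ih (by omega)
      have h2 := hstep k (len k) (by omega) (R.len_nonneg k (by omega))
      have h3 := norm_add_le (breakPoint o dir len k - breakPoint o dir len j) (len k • dir k)
      rw [Finset.sum_range_succ, breakPoint, add_sub_right_comm]
      rcases le_total 0 m with h0 | h0
      · have := mul_le_mul_of_nonneg_left h3 h0
        linarith
      · have h4 : 0 ≤ ∑ i ∈ Finset.range k, w i * len i + w k * len k -
            ∑ i ∈ Finset.range j, w i * len i := by
          have := R.len_nonneg k (by omega)
          have := R.weight_pos k (by omega)
          have h5 : ∑ i ∈ Finset.range j, w i * len i ≤ ∑ i ∈ Finset.range k, w i * len i :=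
            Finset.sum_le_sum_of_subset_of_nonneg (Finset.range_mono hjk) fun i hi _ =>
              mul_nonneg (R.weight_pos i (by have := Finset.mem_range.mp hi; omega)).le
                (R.len_nonneg i (by have := Finset.mem_range.mp hi; omega))
          have : 0 ≤ w k * len k := by positivity
          linarith
        exact (mul_nonpos_of_nonpos_of_nonneg h0 (norm_nonneg _)).trans h4
  have h2 := hstep k s hk hs
  have h3 := norm_add_le (breakPoint o dir len k - breakPoint o dir len j) (s • dir k)
  rw [add_sub_right_comm]
  rcases le_total 0 m with h0 | h0
  · have := mul_le_mul_of_nonneg_left h3 h0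
    linarith
  · have h4 : 0 ≤ ∑ i ∈ Finset.range k, w i * len i - ∑ i ∈ Finset.range j, w i * len i := by
      rw [sub_nonneg]
      exact Finset.sum_le_sum_of_subset_of_nonneg (Finset.range_mono hjk) fun i hi _ =>
        mul_nonneg (R.weight_pos i (by have := Finset.mem_range.mp hi; omega)).le
          (R.len_nonneg i (by have := Finset.mem_range.mp hi; omega))
    have : 0 ≤ w k * s := mul_nonneg (R.weight_pos k hk).le hs
    exact (mul_nonpos_of_nonpos_of_nonneg h0 (norm_nonneg _)).trans (by linarith)

theorem abs_cost_sub_le {W F : ℝ} (hw : ∀ i ≤ p, 0 < w i) (hW : ∀ i ≤ p, w i ≤ W)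
    (hF : ∀ i < p, |len i - len' i| ≤ F) {k : ℕ} (hk : k ≤ p) :
    |∑ i ∈ Finset.range k, w i * len i - ∑ i ∈ Finset.range k, w i * len' i| ≤ p * (W * F) := by
  rcases Nat.eq_zero_or_pos k with rfl | hk0
  · rcases Nat.eq_zero_or_pos p with rfl | hp
    · simp
    · have : 0 ≤ W * F := mul_nonneg ((hw 0 hp.le).le.trans (hW 0 hp.le))
        ((abs_nonneg _).trans (hF 0 hp))
      simpa using mul_nonneg (Nat.cast_nonneg p) this
  rw [← Finset.sum_sub_distrib]
  refine (Finset.abs_sum_le_sum_abs _ _).trans ?_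
  have hWF : 0 ≤ W * F := mul_nonneg ((hw 0 (Nat.zero_le _)).le.trans (hW 0 (Nat.zero_le _)))
    ((abs_nonneg _).trans (hF 0 (by omega)))
  calc _ ≤ ∑ i ∈ Finset.range k, W * F := by
        refine Finset.sum_le_sum fun i hi => ?_
        have hi' : i < p := by have := Finset.mem_range.mp hi; omega
        rw [← mul_sub, abs_mul, abs_of_pos (hw i hi'.le)]
        exact mul_le_mul (hW i hi'.le) (hF i hi') (abs_nonneg _)
          ((hw i hi'.le).le.trans (hW i hi'.le))
    _ = k * (W * F) := by rw [Finset.sum_const, Finset.card_range, nsmul_eq_mul]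
    _ ≤ p * (W * F) := by gcongr

/-- Points at equal weighted distance along two nearby paths are close. -/
theorem norm_sub_le_of_cost_eq (R : Trace ν w h p L o dir len) (R' : Trace ν w h p L o dir' len')
    {m W E F : ℝ} (hm : 0 < m) (hmw : ∀ i ≤ p, m ≤ w i) (hW : ∀ i ≤ p, w i ≤ W)
    (hE : ∀ i ≤ p, gap o dir dir' len len' i ≤ E) (hF0 : 0 ≤ F)
    (hF : ∀ i < p, |len i - len' i| ≤ F)
    {k l : ℕ} (hkl : k ≤ l) (hl : l ≤ p) {s s' : ℝ} (hsk : s ≤ len k) (hs' : 0 ≤ s')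
    (hsl : s' ≤ len' l)
    (hcost : ∑ i ∈ Finset.range k, w i * len i + w k * s =
      ∑ i ∈ Finset.range l, w i * len' i + w l * s') :
    ‖(breakPoint o dir len k + s • dir k) - (breakPoint o dir' len' l + s' • dir' l)‖ ≤
      (1 + L) * E + 2 * (p * (W * F) / m) := by
  have hk : k ≤ p := hkl.trans hl
  have hL : 0 ≤ L := (R.len_nonneg k hk).trans (R.len_le k hk)
  have hE0 : 0 ≤ E := (gap_nonneg k).trans (hE k hk)
  have hdir : ∀ i ≤ p, ‖dir i - dir' i‖ ≤ E := fun i hi =>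
    le_trans (by unfold gap; linarith [norm_nonneg (breakPoint o dir len i -
      breakPoint o dir' len' i)]) (hE i hi)
  have hbr : ∀ i ≤ p, ‖breakPoint o dir len i - breakPoint o dir' len' i‖ ≤ E := fun i hi =>
    le_trans (by unfold gap; linarith [norm_nonneg (dir i - dir' i)]) (hE i hi)
  have hWpos : 0 < W := (R.weight_pos k hk).trans_le (hW k hk)
  have hLE : 0 ≤ L * E := mul_nonneg hL hE0
  have hQ : 0 ≤ p * (W * F) / m := by positivity
  -- If both points lie on the same segment index, `s` and `s'` differ by at most the accumulated
  -- cost difference over `m`.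
  rcases hkl.eq_or_lt with rfl | hlt
  · have hc := abs_cost_sub_le R.weight_pos hW hF hk
    have hss : |s - s'| ≤ p * (W * F) / m := by
      rw [le_div_iff₀ hm]
      have e : w k * (s - s') = -(∑ i ∈ Finset.range k, w i * len i -
        ∑ i ∈ Finset.range k, w i * len' i) := by linear_combination hcost
      have e2 : w k * |s - s'| ≤ p * (W * F) := by
        rw [← abs_of_pos (R.weight_pos k hk), ← abs_mul, e, abs_neg]
        exact hc
      nlinarith [abs_nonneg (s - s'), hmw k hk]
    have e : (breakPoint o dir len k + s • dir k) - (breakPoint o dir' len' k + s' • dir' k) =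
        (breakPoint o dir len k - breakPoint o dir' len' k) + (s - s') • dir k +
          s' • (dir k - dir' k) := by
      simp only [sub_smul, smul_sub]; abel
    rw [e]
    refine (norm_add₃_le).trans ?_
    rw [norm_smul, norm_smul, R.norm_dir k hk, Real.norm_eq_abs, Real.norm_eq_abs, mul_one,
      abs_of_nonneg hs']
    have h1 : s' * ‖dir k - dir' k‖ ≤ L * E :=
      mul_le_mul (hsl.trans (R'.len_le k hk)) (hdir k hk) (norm_nonneg _) hL
    linarith [hbr k hk]
  -- Otherwise the first point is not beyond break point `k + 1` and the second is not before its
  -- own. The cost still missing and the cost in excess add up to the cost difference at these break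
  -- points, so each point is near its break point.
  · have hc := abs_cost_sub_le R.weight_pos hW hF (show k + 1 ≤ p by omega)
    have h1 := R'.mul_norm_sub_le hmw (show k + 1 ≤ l by omega) hl hs'
    rw [← hcost] at h1
    have hsum : ∑ i ∈ Finset.range (k + 1), w i * len i =
      ∑ i ∈ Finset.range k, w i * len i + w k * len k := Finset.sum_range_succ _ _
    have hwk := R.weight_pos k hk
    have h2 : w k * s ≤ w k * len k := mul_le_mul_of_nonneg_left hsk hwk.le
    rw [abs_le] at hc
    have h3 : ‖breakPoint o dir' len' l + s' • dir' l - breakPoint o dir' len' (k + 1)‖ ≤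
        p * (W * F) / m := by
      rw [le_div_iff₀ hm, mul_comm]
      linarith [hc.2]
    have h4 : ‖breakPoint o dir len k + s • dir k - breakPoint o dir len (k + 1)‖ ≤
        p * (W * F) / m := by
      have e : breakPoint o dir len k + s • dir k - breakPoint o dir len (k + 1) =
          -((len k - s) • dir k) := by
        simp only [breakPoint, sub_smul]; abel
      rw [e, norm_neg, norm_smul, R.norm_dir k hk, mul_one, Real.norm_eq_abs,
        abs_of_nonneg (by linarith), le_div_iff₀ hm]
      have h5 : m * (len k - s) ≤ w k * (len k - s) :=
        mul_le_mul_of_nonneg_right (hmw k hk) (by linarith)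
      have h6 : 0 ≤ m * ‖breakPoint o dir' len' l + s' • dir' l - breakPoint o dir' len' (k + 1)‖ :=
        mul_nonneg hm.le (norm_nonneg _)
      linarith [hc.2]
    have e : (breakPoint o dir len k + s • dir k) - (breakPoint o dir' len' l + s' • dir' l) =
        (breakPoint o dir len k + s • dir k - breakPoint o dir len (k + 1)) +
        (breakPoint o dir len (k + 1) - breakPoint o dir' len' (k + 1)) +
        -(breakPoint o dir' len' l + s' • dir' l - breakPoint o dir' len' (k + 1)) := by abel
    rw [e]
    refine (norm_add₃_le).trans ?_
    rw [norm_neg]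
    linarith [hbr (k + 1) (by omega)]

end Trace

/-! ### From rays in the triangulation to abstract traces -/

theorem edgeInterior_subset_convexHull {e f : Finset Plane} (hef : e ⊆ f) :
    edgeInterior e ⊆ convexHull ℝ (f : Set Plane) := by
  rintro x ⟨a, b, -, he, hx⟩
  have ha : a ∈ e := by rw [← Finset.mem_coe, he]; simp
  have hb : b ∈ e := by rw [← Finset.mem_coe, he]; simp
  exact (convex_convexHull ℝ _).openSegment_subset (subset_convexHull ℝ _ (hef ha))
    (subset_convexHull ℝ _ (hef hb)) hx

theorem IsEdgeNormal.inner_eq {f g : Finset Plane} {ν x y : Plane} (hν : IsEdgeNormal f g ν)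
    (hx : x ∈ edgeInterior (sharedEdge f g)) (hy : y ∈ edgeInterior (sharedEdge f g)) :
    (inner ℝ ν x : ℝ) = inner ℝ ν y := by
  obtain ⟨a, b, -, he, -⟩ := id hx
  have ha : a ∈ sharedEdge f g := by rw [← Finset.mem_coe, he]; simp
  have key : ∀ z ∈ edgeInterior (sharedEdge f g), (inner ℝ ν z : ℝ) = inner ℝ ν a := by
    rintro z ⟨c, d, -, he, s, t, -, -, hst, rfl⟩
    have hc : c ∈ sharedEdge f g := by rw [← Finset.mem_coe, he]; simp
    have hd : d ∈ sharedEdge f g := by rw [← Finset.mem_coe, he]; simp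
    have h1 := hν.2.1 a ha c hc
    have h2 := hν.2.1 a ha d hd
    rw [inner_sub_right] at h1 h2
    rw [inner_add_right, inner_smul_right, inner_smul_right]
    linear_combination s * h1 + t * h2 + (inner ℝ ν a) * hst
  rw [key x hx, key y hy]

/-- Both vectors are unit and perpendicular to the edge, hence equal up to sign; the vertex of `g`
off the edge fixes the sign. A point in the edge interior ensures that the triangles share exactly
two vertices. -/
theorem IsEdgeNormal.unique {f g : Finset Plane} {ν ν' : Plane} (hν : IsEdgeNormal f g ν)
    (hν' : IsEdgeNormal f g ν') (hg : g.card = 3) (he : (edgeInterior (sharedEdge f g)).Nonempty) :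
    ν = ν' := by
  classical
  obtain ⟨x, a, b, hab, he, -⟩ := he
  have ha : a ∈ sharedEdge f g := by rw [← Finset.mem_coe, he]; simp
  have hb : b ∈ sharedEdge f g := by rw [← Finset.mem_coe, he]; simp
  obtain ⟨c, hcg, hcf⟩ : ∃ c ∈ g, c ∉ f := by
    by_contra hall
    push Not at hall
    have h1 : sharedEdge f g = g := Finset.inter_eq_right.mpr hall
    rw [h1] at he
    have h2 : g = {a, b} := by
      apply Finset.coe_injective
      rw [he]; simp
    rw [h2, Finset.card_pair hab] at hg
    omega
  have h1 := hν.2.1 a ha b hb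
  have h2 := hν'.2.1 a ha b hb
  have h3 := hν.2.2 a ha c hcg hcf
  have h4 := hν'.2.2 a ha c hcg hcf
  have hcross : (inner ℝ (rot ν) ν' : ℝ) = 0 := by
    by_contra hne
    apply hab
    have hz : ∀ j : Fin 2, (inner ℝ (rot ν) ν' : ℝ) * (b j - a j) = 0 := by
      intro j
      simp only [inner_coord, rot_zero_coord, rot_one_coord, PiLp.sub_apply] at h1 h2 ⊢
      fin_cases j
      · simp only [Fin.zero_eta]; linear_combination ν' 1 * h1 - ν 1 * h2
      · simp only [Fin.mk_one]; linear_combination (-ν' 0) * h1 + ν 0 * h2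
    ext j
    linarith [(mul_eq_zero.mp (hz j)).resolve_left hne]
  have hfr := eq_frame hν.1 ν'
  have hsq := sq_add_sq_frame hν.1 hν'.1
  rw [hcross, zero_smul, add_zero] at hfr
  rw [hcross, zero_pow two_ne_zero, add_zero] at hsq
  rcases sq_eq_sq_iff_eq_or_eq_neg.mp (hsq.trans (one_pow 2).symm) with h | h
  · rw [h, one_smul] at hfr
    exact hfr.symm
  · rw [h, neg_one_smul] at hfr
    rw [hfr, inner_neg_left] at h4
    linarith

theorem inner_pos_of_angle_lt {ν v : Plane} (hν : ‖ν‖ = 1) (hv : ‖v‖ = 1)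
    (h : InnerProductGeometry.angle ν v < Real.pi / 2) : 0 < (inner ℝ ν v : ℝ) := by
  rw [← InnerProductGeometry.cos_angle_mul_norm_mul_norm, hν, hv]
  have := Real.cos_pos_of_mem_Ioo
    ⟨by linarith [InnerProductGeometry.angle_nonneg ν v, Real.pi_pos], h⟩
  simpa using this

namespace WeightedTriangulation

variable (T : WeightedTriangulation)

theorem exists_diam : ∃ L : ℝ, 0 < L ∧ ∀ f ∈ T.triangles, ∀ x ∈ convexHull ℝ (f : Set Plane),
    ∀ y ∈ convexHull ℝ (f : Set Plane), ‖x - y‖ ≤ L := by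
  have hb : Bornology.IsBounded (⋃ f ∈ T.triangles, convexHull ℝ (f : Set Plane)) := by
    rw [Bornology.isBounded_biUnion_finset]
    exact fun f _ => isBounded_convexHull.mpr f.finite_toSet.isBounded
  obtain ⟨C, hC⟩ := Metric.isBounded_iff.mp hb
  refine ⟨max C 1, by positivity, fun f hf x hx y hy => ?_⟩
  rw [← dist_eq_norm]
  exact (hC (Set.mem_biUnion hf hx) (Set.mem_biUnion hf hy)).trans (le_max_left _ _)

end WeightedTriangulation

theorem Ray.exists_normal {T : WeightedTriangulation} (r : Ray T) :
    ∃ ν : ℕ → Plane, ∀ i < r.p, IsEdgeNormal (r.face i) (r.face (i + 1)) (ν i) := by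
  have : ∀ i, ∃ ν, i < r.p → IsEdgeNormal (r.face i) (r.face (i + 1)) ν := by
    intro i
    by_cases hi : i < r.p
    · obtain ⟨ν, hν, -⟩ := r.refracts i hi
      exact ⟨ν, fun _ => hν⟩
    · exact ⟨0, fun h => absurd h hi⟩
  choose ν hν using this
  exact ⟨ν, hν⟩

theorem Ray.breakPoint_mem {T : WeightedTriangulation} (r : Ray T) {i : ℕ} (hi : i ≤ r.p) :
    breakPoint r.source r.dir r.len i ∈ convexHull ℝ (r.face i : Set Plane) := by
  cases i with
  | zero => exact r.source_mem
  | succ i => exact edgeInterior_subset_convexHull Finset.inter_subset_right (r.cross i hi)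

theorem Ray.breakPoint_succ_mem {T : WeightedTriangulation} (r : Ray T) {i : ℕ} (hi : i ≤ r.p) :
    breakPoint r.source r.dir r.len (i + 1) ∈ convexHull ℝ (r.face i : Set Plane) := by
  rcases hi.eq_or_lt with rfl | hlt
  · exact r.end_mem
  · exact edgeInterior_subset_convexHull Finset.inter_subset_left (r.cross i hlt)

/-- Rays that traverse the same triangles cross the same lines. -/
theorem Ray.trace {T : WeightedTriangulation} {L : ℝ}
    (hL : ∀ f ∈ T.triangles, ∀ x ∈ convexHull ℝ (f : Set Plane),
      ∀ y ∈ convexHull ℝ (f : Set Plane), ‖x - y‖ ≤ L)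
    {o : Plane} {p : ℕ} {face : ℕ → Finset Plane} {ν : ℕ → Plane} {r₀ r : Ray T}
    (h₀ : Traverses r₀ o p face) (hr : Traverses r o p face)
    (hν : ∀ i < p, IsEdgeNormal (face i) (face (i + 1)) (ν i)) :
    Trace ν (fun i => T.weight (face i))
      (fun i => inner ℝ (ν i) (breakPoint o r₀.dir r₀.len (i + 1))) p L o r.dir r.len := by
  obtain ⟨rfl, rfl, hf⟩ := hr
  obtain ⟨hs₀, hp₀, hf₀⟩ := h₀
  have href : ∀ i < r.p, ∃ ν' : Plane, ν i = ν' ∧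
      InnerProductGeometry.angle ν' (r.dir i) < Real.pi / 2 ∧
      InnerProductGeometry.angle ν' (r.dir (i + 1)) < Real.pi / 2 ∧
      T.weight (face i) • (r.dir i - inner ℝ ν' (r.dir i) • ν') =
        T.weight (face (i + 1)) • (r.dir (i + 1) - inner ℝ ν' (r.dir (i + 1)) • ν') := by
    intro i hi
    obtain ⟨ν', hν', h⟩ := r.refracts i hi
    rw [hf i hi.le, hf (i + 1) hi] at hν' h
    refine ⟨ν', (hν i hi).unique hν' ?_ ⟨breakPoint r.source r.dir r.len (i + 1), ?_⟩, h⟩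
    · exact ((T.mem_triangles _).mp (hf (i + 1) hi ▸ r.face_mem (i + 1) hi)).2
    · have := r.cross i hi
      rwa [hf i hi.le, hf (i + 1) hi] at this
  exact
  { norm_normal := fun i hi => (hν i hi).1
    norm_dir := r.norm_dir
    weight_pos := fun i hi => T.weight_pos _ (hf i hi ▸ r.face_mem i hi)
    inner_in := fun i hi => by
      obtain ⟨_, rfl, h, -⟩ := href i hi
      exact inner_pos_of_angle_lt (hν i hi).1 (r.norm_dir i hi.le) h
    inner_out := fun i hi => by
      obtain ⟨_, rfl, -, h, -⟩ := href i hi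
      exact inner_pos_of_angle_lt (hν i hi).1 (r.norm_dir (i + 1) hi) h
    snell := fun i hi => by
      obtain ⟨_, rfl, -, -, h⟩ := href i hi
      have h2 := congrArg (fun x => (inner ℝ (rot (ν i)) x : ℝ)) h
      simpa only [inner_smul_right, inner_sub_right, real_inner_comm (ν i) (rot (ν i)),
        inner_rot_self, mul_zero, sub_zero] using h2
    line := fun i hi => by
      refine (hν i hi).inner_eq ?_ ?_
      · have := r.cross i hi
        rwa [hf i hi.le, hf (i + 1) hi] at this
      · have := r₀.cross i (by omega)
        rwa [hf₀ i hi.le, hf₀ (i + 1) hi, hs₀] at this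
    len_pos := r.len_pos
    len_nonneg := fun i hi => by
      rcases hi.eq_or_lt with rfl | hlt
      · exact r.len_nonneg
      · exact (r.len_pos i hlt).le
    len_le := fun i hi => by
      have h1 := hL _ (r.face_mem i hi) _ (r.breakPoint_succ_mem hi) _ (r.breakPoint_mem hi)
      rw [breakPoint, add_sub_cancel_left, norm_smul, r.norm_dir i hi, mul_one] at h1
      exact (le_abs_self _).trans h1 }

/-! ### Finitely many face sequences and critical sources -/

namespace WeightedTriangulation

variable (T : WeightedTriangulation)

/-- A sequence of triangles that is eventually constant. -/
def facesOf {T : WeightedTriangulation} {N : ℕ} (F : Fin (N + 1) → T.triangles) (i : ℕ) :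
    Finset Plane :=
  F ⟨min i N, by omega⟩

theorem exists_facesOf {N p : ℕ} {face : ℕ → Finset Plane} (hp : p ≤ N)
    (hface : ∀ i ≤ p, face i ∈ T.triangles) :
    ∃ F : Fin (N + 1) → T.triangles, ∀ i ≤ p, face i = facesOf F i := by
  classical
  obtain ⟨f₀, hf₀⟩ := T.nonempty
  refine ⟨fun j => if h : face j ∈ T.triangles then ⟨face j, h⟩ else ⟨f₀, hf₀⟩, fun i hi => ?_⟩
  have h1 : min i N = i := min_eq_left (hi.trans hp)
  simp [facesOf, h1, hface i hi]

/-- The directions at the critical angle to the edge between two triangles. -/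
def criticalDirs (f g : Finset Plane) : Set Plane :=
  {v | ‖v‖ = 1 ∧ IsCritical T f g v ∧ (edgeInterior (sharedEdge f g)).Nonempty}

/-- The critical angle prescribes the component along the unique normal, which leaves at most two
unit vectors. -/
theorem finite_criticalDirs {f g : Finset Plane} (hg : g.card = 3) :
    (T.criticalDirs f g).Finite := by
  rcases (T.criticalDirs f g).eq_empty_or_nonempty with h | ⟨v₀, -, ⟨-, ν, hν, -⟩, hne⟩
  · rw [h]; exact Set.finite_empty
  set c : ℝ := Real.cos (Real.arcsin (T.weight g / T.weight f)) with hc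
  refine Set.Finite.subset (Set.toFinite {c • ν + √(1 - c ^ 2) • rot ν,
    c • ν + (-√(1 - c ^ 2)) • rot ν}) ?_
  rintro v ⟨hv, ⟨-, ν', hν', hang⟩, -⟩
  obtain rfl := hν.unique hν' hg hne
  have hcv : (inner ℝ ν v : ℝ) = c := by
    rw [← InnerProductGeometry.cos_angle_mul_norm_mul_norm, hang, hν.1, hv, mul_one, mul_one]
  have hsq := sq_add_sq_frame hν.1 hv
  have hfr := eq_frame hν.1 v
  rw [hcv] at hsq hfr
  have habs : |(inner ℝ (rot ν) v : ℝ)| = √(1 - c ^ 2) := by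
    rw [← Real.sqrt_sq_eq_abs]; congr 1; linarith
  rw [hfr]
  rcases abs_choice (inner ℝ (rot ν) v : ℝ) with h | h
  · left; rw [← habs, h]
  · right; rw [Set.mem_singleton_iff, ← habs, h, neg_neg]

/-- The points where rays from `o` that traverse given triangles strike the edge towards `g` with
last direction `v`, at the critical angle. -/
def criticalTips (o : Plane) (p : ℕ) (face : ℕ → Finset Plane) (g : Finset Plane) (v : Plane) :
    Set Plane :=
  {x | ∃ r : Ray T, Traverses r o p face ∧ r.dir p = v ∧ IsCritical T (face p) g v ∧
    r.tip ∈ edgeInterior (sharedEdge (face p) g) ∧ r.tip = x}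

/-- Snell's law can be run backwards, so the last direction and the start determine the path up to
its last break point. Since `w_g < w_f`, the critical angle is below `π / 2` and the final line
meets the edge transversally, in one point. -/
theorem subsingleton_criticalTips {o : Plane} {p : ℕ} {face : ℕ → Finset Plane}
    {g : Finset Plane} (v : Plane) : (T.criticalTips o p face g v).Subsingleton := by
  rintro x ⟨r, hr, hv, ⟨hlt, ν, hν, hang⟩, htip, rfl⟩ y ⟨r', hr', hv', -, htip', rfl⟩
  obtain ⟨L, -, hL⟩ := T.exists_diam
  obtain ⟨N, hN⟩ := r.exists_normal
  have hN' : ∀ i < p, IsEdgeNormal (face i) (face (i + 1)) (N i) := by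
    intro i hi
    have := hN i (hr.2.1 ▸ hi)
    rwa [hr.2.2 i hi.le, hr.2.2 (i + 1) hi] at this
  have R := Ray.trace hL hr hr hN'
  have R' := Ray.trace hL hr hr' hN'
  have hb := R.breakPoint_eq R' (R.eq_of_dir_last R' (hv.trans hv'.symm)) p le_rfl
  have hinner := hν.inner_eq htip htip'
  have hvn : ‖v‖ = 1 := by rw [← hv]; exact r.norm_dir p hr.2.1.ge
  have hmemf : 0 < T.weight (face p) := R.weight_pos p le_rfl
  have hpos : 0 < (inner ℝ ν v : ℝ) := by
    refine inner_pos_of_angle_lt hν.1 hvn ?_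
    rw [hang, Real.arcsin_lt_pi_div_two, div_lt_one hmemf]
    exact hlt
  have ht : r.tip = breakPoint o r.dir r.len p + r.len p • v := by
    rw [Ray.tip, hr.1, hr.2.1, breakPoint, hv]
  have ht' : r'.tip = breakPoint o r.dir r.len p + r'.len p • v := by
    rw [Ray.tip, hr'.1, hr'.2.1, breakPoint, hv', hb]
  rw [ht, ht', inner_add_right, inner_add_right, inner_smul_right, inner_smul_right] at hinner
  rw [ht, ht', mul_right_cancel₀ hpos.ne' (add_left_cancel hinner)]

/-- The nodes of all trees of rays that are reached after at most `k` edges. -/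
def sources (k : ℕ) : Set Plane :=
  {o | ∃ R u j f, j ≤ k ∧ IsSource T R u j o f}

/-- Induction on the number of edges: a critical source is determined by its parent, a face
sequence, the next face and a critical direction, each from a finite set that does not involve the
sets `R o`. -/
theorem finite_sources (k : ℕ) : (T.sources k).Finite := by
  induction k with
  | zero =>
    refine T.finite_vertices.subset ?_
    rintro o ⟨R, u, j, f, hj, h⟩
    cases h with
    | root f hu => exact hu
    | critical => omega
  | succ m ih =>
    have hfin : (T.K.vertices ∪ ⋃ o ∈ T.sources m, ⋃ p ∈ Set.Iic m,
        ⋃ F : Fin (m + 1) → T.triangles, ⋃ g ∈ T.triangles,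
          ⋃ v ∈ T.criticalDirs (facesOf F p) g, T.criticalTips o p (facesOf F) g v).Finite := by
      refine T.finite_vertices.union (ih.biUnion fun o _ => (Set.finite_Iic m).biUnion fun p _ =>
        Set.finite_iUnion fun F => T.triangles.finite_toSet.biUnion fun g hg =>
          (T.finite_criticalDirs ((T.mem_triangles g).mp hg).2).biUnion fun v _ =>
            (T.subsingleton_criticalTips v).finite)
    refine hfin.subset ?_
    rintro o ⟨R, u, j, f, hj, h⟩
    cases h with
    | root f hu => exact Or.inl hu
    | critical k r g hsource hdir hlen hg htip hcrit =>
      right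
      obtain ⟨F, hF⟩ := T.exists_facesOf (show r.p ≤ m by omega) r.face_mem
      simp only [Set.mem_iUnion, exists_prop]
      rw [hF r.p le_rfl] at htip hcrit
      exact ⟨r.source, ⟨R, u, k, _, by omega, hsource⟩, r.p, Set.mem_Iic.mpr (by omega), F, _, hg,
        r.dir r.p, ⟨r.norm_dir _ le_rfl, hcrit, ⟨_, htip⟩⟩, r, ⟨rfl, rfl, hF⟩, rfl, hcrit, htip, rfl⟩

/-! ### Bounds by the extreme weights and for normal components -/

theorem wMin_le {f : Finset Plane} (hf : f ∈ T.triangles) : T.wMin ≤ T.weight f :=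
  Finset.inf'_le T.weight hf

theorem le_wMax {f : Finset Plane} (hf : f ∈ T.triangles) : T.weight f ≤ T.wMax :=
  Finset.le_sup' T.weight hf

theorem wMin_pos : 0 < T.wMin := by
  rw [wMin, Finset.lt_inf'_iff]
  exact fun f hf => T.weight_pos f hf

theorem wMin_le_wMax : T.wMin ≤ T.wMax := by
  obtain ⟨f, hf⟩ := T.nonempty
  exact (T.wMin_le hf).trans (T.le_wMax hf)

theorem wMax_pos : 0 < T.wMax := T.wMin_pos.trans_le T.wMin_le_wMax

theorem one_le_mu : 1 ≤ T.mu := by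
  rw [mu, one_le_div T.wMin_pos]
  exact T.wMin_le_wMax

theorem weight_le_mu_mul {f g : Finset Plane} (hf : f ∈ T.triangles) (hg : g ∈ T.triangles) :
    T.weight f ≤ T.mu * T.weight g := by
  have h1 : T.mu * T.wMin = T.wMax := div_mul_cancel₀ _ T.wMin_pos.ne'
  calc T.weight f ≤ T.wMax := T.le_wMax hf
    _ = T.mu * T.wMin := h1.symm
    _ ≤ T.mu * T.weight g :=
      mul_le_mul_of_nonneg_left (T.wMin_le hg) (zero_le_one.trans T.one_le_mu)

theorem segmentCost_le (a b : Plane) : T.segmentCost a b ≤ T.wMax * ‖b - a‖ := by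
  have h := intervalIntegral.integral_mono_on zero_le_one (T.intervalIntegrable_segmentCost a b)
    (intervalIntegrable_const (c := T.wMax * ‖b - a‖)) (fun t _ =>
      mul_le_mul_of_nonneg_right ((le_abs_self _).trans (T.abs_pointWeight_le _)) (norm_nonneg _))
  simpa [segmentCost] using h

end WeightedTriangulation

/-- Entering a triangle that is not lighter bends the path towards the normal, so the incidence
bound survives refraction. -/
theorem Trace.inner_le_inner_succ {ν : ℕ → Plane} {w h : ℕ → ℝ} {p : ℕ} {L : ℝ} {o : Plane}
    {dir : ℕ → Plane} {len : ℕ → ℝ} (R : Trace ν w h p L o dir len) {i : ℕ} (hi : i < p)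
    (hw : w i ≤ w (i + 1)) : (inner ℝ (ν i) (dir i) : ℝ) ≤ inner ℝ (ν i) (dir (i + 1)) := by
  have h1 := R.snell i hi
  have f1 := R.frame_sq_in hi
  have f2 := R.frame_sq_out hi
  have hw0 := R.weight_pos i hi.le
  have hw1 := R.weight_pos (i + 1) hi
  refine le_of_sq_le_sq ?_ (R.inner_out i hi).le
  have h2 : |(inner ℝ (rot (ν i)) (dir (i + 1)) : ℝ)| ≤ |(inner ℝ (rot (ν i)) (dir i) : ℝ)| := by
    refine le_of_mul_le_mul_left ?_ hw1
    have e : w (i + 1) * |(inner ℝ (rot (ν i)) (dir (i + 1)) : ℝ)| =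
        w i * |(inner ℝ (rot (ν i)) (dir i) : ℝ)| := by
      rw [← abs_of_pos hw1, ← abs_mul, ← h1, abs_mul, abs_of_pos hw0]
    rw [e]
    exact mul_le_mul_of_nonneg_right hw (abs_nonneg _)
  have h3 := sq_le_sq.mpr h2
  linarith

/-- The cosine of the refraction angle is at least `sin ε ≥ (2 / π) * ε`, and `π ≤ 4`. -/
theorem Ray.AwayFromCritical.le_inner {T : WeightedTriangulation} {r : Ray T} {ε : ℝ}
    (hr : r.AwayFromCritical ε) (hε : 0 < ε) (hε1 : ε ≤ 1) {i : ℕ} (hi : i < r.p)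
    (hlt : T.weight (r.face (i + 1)) < T.weight (r.face i)) {ν : Plane}
    (hν : IsEdgeNormal (r.face i) (r.face (i + 1)) ν) :
    ε / 2 ≤ inner ℝ ν (r.dir (i + 1)) := by
  have h := hr i hi hlt ν hν
  rw [← InnerProductGeometry.cos_angle_mul_norm_mul_norm, hν.1, r.norm_dir (i + 1) hi, mul_one,
    mul_one]
  have h1 := Real.cos_le_cos_of_nonneg_of_le_pi (InnerProductGeometry.angle_nonneg _ _)
    (by linarith [Real.pi_pos]) h
  rw [Real.cos_pi_div_two_sub] at h1
  have h2 := Real.mul_le_sin hε.le (by linarith [Real.pi_gt_three])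
  have h3 : 1 / 2 ≤ 2 / Real.pi := by
    rw [div_le_div_iff₀ two_pos Real.pi_pos]; linarith [Real.pi_le_four]
  nlinarith

/-! ### The estimate for one face sequence, and the theorem -/

/-- Rays from the same point that are nearly parallel stay close across the same triangles. -/
theorem gap_le_of_awayFromCritical (T : WeightedTriangulation) {o : Plane} {p : ℕ} {face : ℕ → Finset Plane}
    (hp : p ≤ T.n ^ 2) {ν : ℕ → Plane} {h : ℕ → ℝ} {L c : ℝ} (hL : 0 ≤ L) (hc : 0 < c)
    (hc2 : c ≤ 1 / 2) (hν : ∀ i < p, IsEdgeNormal (face i) (face (i + 1)) (ν i))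
    {r r' : Ray T} (hr : Traverses r o p face) (hr' : Traverses r' o p face)
    (R : Trace ν (fun i => T.weight (face i)) h p L o r.dir r.len)
    (R' : Trace ν (fun i => T.weight (face i)) h p L o r'.dir r'.len)
    (hin : ∀ i < p, c ≤ inner ℝ (ν i) (r.dir i)) (hin' : ∀ i < p, c ≤ inner ℝ (ν i) (r'.dir i))
    {ε : ℝ} (hε : 0 < ε) (hε1 : ε ≤ 1) (ha : r.AwayFromCritical ε) (ha' : r'.AwayFromCritical ε)
    (hang : InnerProductGeometry.angle (r.dir 0) (r'.dir 0) ≤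
      ε ^ (T.n ^ 2) * ε / (2 * T.mu)) :
    ∀ i ≤ p, Trace.gap o r.dir r'.dir r.len r'.len i ≤
      (2 * T.mu / c + (1 + (1 + L) / c + L)) ^ (T.n ^ 2) * ε ^ 2 := by
  have hmu := T.one_le_mu
  have hface : ∀ i ≤ p, face i ∈ T.triangles := fun i hi =>
    hr.2.2 i hi ▸ r.face_mem i (hr.2.1.symm ▸ hi)
  set K : ℝ := 2 * T.mu / c + (1 + (1 + L) / c + L) with hK
  have hK1 : 1 ≤ K := by
    have h1 : 0 ≤ 2 * T.mu / c := by positivity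
    have h2 : 0 ≤ (1 + L) / c := by positivity
    linarith
  have hout : ∀ s : Ray T, Traverses s o p face → s.AwayFromCritical ε →
      Trace ν (fun i => T.weight (face i)) h p L o s.dir s.len →
      (∀ i < p, c ≤ inner ℝ (ν i) (s.dir i)) → ∀ i < p,
      c * (if T.weight (face (i + 1)) < T.weight (face i) then ε else 1) ≤
        inner ℝ (ν i) (s.dir (i + 1)) := by
    rintro s ⟨-, rfl, hs⟩ has S hsin i hi
    split_ifs with hlt
    · have hνi := hν i hi
      rw [← hs i hi.le, ← hs (i + 1) hi] at hνi hlt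
      exact le_trans (by nlinarith) (has.le_inner hε hε1 hi hlt hνi)
    · rw [mul_one]
      exact (hsin i hi).trans (S.inner_le_inner_succ hi (not_lt.mp hlt))
  have hiter := Trace.prod_mul_gap_le (p := p) (o := o) (dir := r.dir) (dir' := r'.dir)
    (len := r.len) (len' := r'.len) (K := K)
    (g := fun i => if T.weight (face (i + 1)) < T.weight (face i) then ε else 1)
    (zero_le_one.trans hK1) (fun i _ => by split_ifs <;> positivity)
    (fun i hi => R.gap_succ_le R' hi hc (by linarith) (by split_ifs <;> positivity)
      (by split_ifs <;> linarith)
      (T.weight_le_mu_mul (hface i hi.le) (hface (i + 1) hi)) (hin i hi)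
      (hout r hr ha R hin i hi) (hout r' hr' ha' R' hin' i hi))
  intro i hi
  have h0 : Trace.gap o r.dir r'.dir r.len r'.len 0 ≤ ε ^ (T.n ^ 2) * ε := by
    have e : Trace.gap o r.dir r'.dir r.len r'.len 0 = ‖r.dir 0 - r'.dir 0‖ := by
      simp [Trace.gap, breakPoint]
    rw [e]
    refine (norm_sub_le_angle_of_norm_eq_one (R.norm_dir 0 (Nat.zero_le _))
      (R'.norm_dir 0 (Nat.zero_le _))).trans (hang.trans (div_le_self (by positivity) ?_))
    linarith
  -- At most `n ^ 2 - 1` of the factors are `ε`. The initial gap carries `ε ^ (n ^ 2 + 1)`, so `ε ^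
  -- 2` is left.
  have hG : ε ^ (T.n ^ 2 - 1) ≤ ∏ j ∈ Finset.range i,
      (if T.weight (face (j + 1)) < T.weight (face j) then ε else 1) := by
    rw [Finset.prod_ite, Finset.prod_const, Finset.prod_const_one, mul_one]
    refine pow_le_pow_of_le_one hε.le hε1 ?_
    have := T.card_lighter_lt (p := i) (face := face) (fun j hj => hface j (hj.trans hi))
      (hi.trans hp)
    omega
  have hN : 0 < T.n ^ 2 := (Finset.card_pos.mpr T.nonempty).trans_le T.card_triangles_le
  have hpos : 0 < ε ^ (T.n ^ 2 - 1) := by positivity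
  refine le_of_mul_le_mul_left ?_ hpos
  calc _ ≤ _ := mul_le_mul_of_nonneg_right hG (Trace.gap_nonneg i)
    _ ≤ _ := hiter i hi
    _ ≤ K ^ (T.n ^ 2) * (ε ^ (T.n ^ 2) * ε) :=
      mul_le_mul (pow_le_pow_right₀ hK1 (hi.trans hp)) h0 (Trace.gap_nonneg 0) (by positivity)
    _ = ε ^ (T.n ^ 2 - 1) * (K ^ (T.n ^ 2) * ε ^ 2) := by
      conv_lhs => rw [← Nat.sub_add_cancel hN, pow_succ ε]
      rw [Nat.sub_add_cancel hN]
      ring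

/-- The claim for rays from a given point that traverse given triangles. -/
theorem eventually_segmentCost_le (T : WeightedTriangulation) (o : Plane) (p : ℕ)
    (face : ℕ → Finset Plane) (hp : p ≤ T.n ^ 2) :
    ∀ᶠ ε in 𝓝[>] (0 : ℝ), ∀ r r' : Ray T, Traverses r o p face → Traverses r' o p face →
      r.AwayFromCritical ε → r'.AwayFromCritical ε →
      InnerProductGeometry.angle (r.dir 0) (r'.dir 0) ≤ ε ^ (T.n ^ 2) * ε / (2 * T.mu) →
      ∀ (d : ℝ) (q q' : Plane), r.PointAt d q → r'.PointAt d q' → T.segmentCost q q' ≤ d * ε := by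
  by_cases hex : ∃ r₀ : Ray T, Traverses r₀ o p face
  swap
  · exact Eventually.of_forall fun ε r _ hr => absurd ⟨r, hr⟩ hex
  obtain ⟨r₀, h₀⟩ := hex
  obtain ⟨L, hL0, hL⟩ := T.exists_diam
  obtain ⟨ν, hν₀⟩ := r₀.exists_normal
  have hν : ∀ i < p, IsEdgeNormal (face i) (face (i + 1)) (ν i) := by
    intro i hi
    have := hν₀ i (h₀.2.1.symm ▸ hi)
    rwa [h₀.2.2 i hi.le, h₀.2.2 (i + 1) hi] at this
  have htr := fun (r : Ray T) (hr : Traverses r o p face) => Ray.trace hL h₀ hr hν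
  obtain ⟨c₀, hc₀, hlow⟩ := Trace.exists_uniform_lower_bound ν (fun i => T.weight (face i))
    (fun i => inner ℝ (ν i) (breakPoint o r₀.dir r₀.len (i + 1))) p L o
  set c : ℝ := min c₀ (1 / 2) with hc
  have hcpos : 0 < c := lt_min hc₀ (by norm_num)
  have hcc : c ≤ c₀ := min_le_left _ _
  have hc2 : c ≤ 1 / 2 := min_le_right _ _
  have hface : ∀ i ≤ p, face i ∈ T.triangles := fun i hi =>
    h₀.2.2 i hi ▸ r₀.face_mem i (h₀.2.1.symm ▸ hi)
  have hm := T.wMin_pos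
  have hW := T.wMax_pos
  set K : ℝ := (2 * T.mu / c + (1 + (1 + L) / c + L)) ^ (T.n ^ 2) with hK
  have hmu := T.one_le_mu
  have hKpos : 0 < K := by positivity
  set C : ℝ := (1 + L) * K + 2 * (p * (T.wMax * ((1 + L) / c * K)) / T.wMin) with hC
  have hCpos : 0 < C := by positivity
  -- The weighted distance will be at most `wMax * C * ε ^ 2` and `d` at least `wMin * c`; the
  -- second threshold makes the former at most `d * ε`.
  filter_upwards [Ioc_mem_nhdsGT one_pos,
    Ioc_mem_nhdsGT (show 0 < T.wMin * c / (T.wMax * C) by positivity)] with ε hε hεC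
  obtain ⟨hε0, hε1⟩ := hε
  have hεC' : T.wMax * C * ε ≤ T.wMin * c := by
    have := hεC.2
    rwa [le_div_iff₀ (by positivity), mul_comm] at this
  have key : ∀ r r' : Ray T, Traverses r o p face → Traverses r' o p face →
      r.AwayFromCritical ε → r'.AwayFromCritical ε →
      InnerProductGeometry.angle (r.dir 0) (r'.dir 0) ≤ ε ^ (T.n ^ 2) * ε / (2 * T.mu) →
      ∀ (d : ℝ) (k l : ℕ) (s s' : ℝ), k ≤ l → l ≤ p → 0 ≤ s → s ≤ r.len k → 0 ≤ s' →
        s' ≤ r'.len l →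
        d = ∑ i ∈ Finset.range k, T.weight (face i) * r.len i + T.weight (face k) * s →
        d = ∑ i ∈ Finset.range l, T.weight (face i) * r'.len i + T.weight (face l) * s' →
        T.wMax * ‖(breakPoint o r.dir r.len k + s • r.dir k) -
          (breakPoint o r'.dir r'.len l + s' • r'.dir l)‖ ≤ d * ε := by
    intro r r' hr hr' ha ha' hang d k l s s' hkl hl hs hsk hs' hsl hd hd'
    have R := htr r hr
    have R' := htr r' hr'
    -- While both points are in the first triangle `d` may be arbitrarily small, so the bound has to
    -- be proportional to `s`. The `μ` in the angle hypothesis turns `wMax` into `wMin`.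
    rcases Nat.eq_zero_or_pos l with rfl | hl0
    · obtain rfl : k = 0 := by omega
      simp only [Finset.range_zero, Finset.sum_empty, zero_add] at hd hd'
      have hw0 := R.weight_pos 0 (Nat.zero_le _)
      obtain rfl : s = s' := mul_left_cancel₀ hw0.ne' (hd.symm.trans hd')
      have hΔ : ‖r.dir 0 - r'.dir 0‖ ≤ ε / T.mu := by
        refine (norm_sub_le_angle_of_norm_eq_one (R.norm_dir 0 (Nat.zero_le _))
          (R'.norm_dir 0 (Nat.zero_le _))).trans (hang.trans ?_)
        rw [div_le_div_iff₀ (by positivity) (by positivity)]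
        have h1 : ε ^ (T.n ^ 2) * ε ≤ 1 * ε :=
          mul_le_mul_of_nonneg_right (pow_le_one₀ hε0.le hε1) hε0.le
        nlinarith
      have hWm : T.wMax * (ε / T.mu) = T.wMin * ε := by
        rw [WeightedTriangulation.mu]; field_simp
      simp only [breakPoint]
      rw [add_sub_add_left_eq_sub, ← smul_sub, norm_smul, Real.norm_eq_abs, abs_of_nonneg hs]
      calc T.wMax * (s * ‖r.dir 0 - r'.dir 0‖) ≤ T.wMax * (s * (ε / T.mu)) := by gcongr
        _ = s * (T.wMax * (ε / T.mu)) := by ring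
        _ = s * (T.wMin * ε) := by rw [hWm]
        _ ≤ s * (T.weight (face 0) * ε) := by
          gcongr
          exact T.wMin_le (hface 0 (Nat.zero_le _))
        _ = d * ε := by rw [hd]; ring
    · have hp0 : 0 < p := hl0.trans_le hl
      obtain ⟨hin, -⟩ := hlow _ _ R
      obtain ⟨hin', hlen'⟩ := hlow _ _ R'
      have hgap := gap_le_of_awayFromCritical T hp hL0.le hcpos hc2 hν hr hr' R R'
        (fun i hi => hcc.trans (hin i hi)) (fun i hi => hcc.trans (hin' i hi)) hε0 hε1 ha ha' hang
      rw [← hK] at hgap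
      have hlen : ∀ i < p, |r.len i - r'.len i| ≤ (1 + L) / c * (K * ε ^ 2) := fun i hi =>
        (R.abs_len_sub_le_gap R' hi hcpos (hcc.trans (hin i hi))).trans
          (mul_le_mul_of_nonneg_left (hgap i hi.le) (by positivity))
      have hdist := R.norm_sub_le_of_cost_eq R' hm (fun i hi => T.wMin_le (hface i hi))
        (fun i hi => T.le_wMax (hface i hi)) hgap (by positivity) hlen hkl hl hsk hs' hsl
        (hd.symm.trans hd')
      have hdist' : ‖(breakPoint o r.dir r.len k + s • r.dir k) -
          (breakPoint o r'.dir r'.len l + s' • r'.dir l)‖ ≤ C * ε ^ 2 := by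
        refine hdist.trans (le_of_eq ?_)
        rw [hC]; ring
      -- As `0 < l`, the path to the second point contains its whole initial segment, of length at
      -- least `c`.
      have hdlow : T.wMin * c ≤ d := by
        have h1 : T.weight (face 0) * r'.len 0 ≤
            ∑ i ∈ Finset.range l, T.weight (face i) * r'.len i :=
          Finset.single_le_sum (f := fun i => T.weight (face i) * r'.len i)
            (fun i hi => by
              have hi' : i ≤ p := by have := Finset.mem_range.mp hi; omega
              exact mul_nonneg (R'.weight_pos i hi').le (R'.len_nonneg i hi'))
            (Finset.mem_range.mpr hl0)
        have h2 : 0 ≤ T.weight (face l) * s' := mul_nonneg (R'.weight_pos l hl).le hs'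
        have h3 : T.wMin * c ≤ T.weight (face 0) * r'.len 0 :=
          mul_le_mul (T.wMin_le (hface 0 (Nat.zero_le _))) (hcc.trans (hlen' hp0)) hcpos.le
            (R'.weight_pos 0 (Nat.zero_le _)).le
        linarith
      calc _ ≤ T.wMax * (C * ε ^ 2) := mul_le_mul_of_nonneg_left hdist' hW.le
        _ = T.wMax * C * ε * ε := by ring
        _ ≤ T.wMin * c * ε := by gcongr
        _ ≤ d * ε := by gcongr
  have hcongr : ∀ r : Ray T, Traverses r o p face → ∀ k ≤ p,
      ∑ i ∈ Finset.range k, T.weight (r.face i) * r.len i =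
        ∑ i ∈ Finset.range k, T.weight (face i) * r.len i := fun r hr k hk =>
    Finset.sum_congr rfl fun i hi => by
      rw [hr.2.2 i (by have := Finset.mem_range.mp hi; omega)]
  intro r r' hr hr' ha ha' hang d q q' hq hq'
  obtain ⟨k, hk, s, hs, hsk, rfl, hd⟩ := hq
  obtain ⟨l, hl, s', hs', hsl, rfl, hd'⟩ := hq'
  rw [hr.2.1] at hk
  rw [hr'.2.1] at hl
  rw [hcongr r hr k hk, hr.2.2 k hk] at hd
  rw [hcongr r' hr' l hl, hr'.2.2 l hl] at hd'
  refine (T.segmentCost_le _ _).trans ?_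
  rw [hr.1, hr'.1]
  rcases le_total k l with hkl | hlk
  · rw [norm_sub_rev]
    exact key r r' hr hr' ha ha' hang d k l s s' hkl hl hs hsk hs' hsl hd hd'
  · exact key r' r hr' hr ha' ha (by rwa [InnerProductGeometry.angle_comm]) d l k s' s hlk hk hs'
      hsl hs hsk hd' hd

end WSP

theorem mainTheorem4 (T : WSP.WeightedTriangulation) :
    ∃ ε₀ : ℝ, 0 < ε₀ ∧ ∀ ε : ℝ, 0 < ε → ε ≤ ε₀ →
      ∀ R : WSP.Plane → Finset WSP.Plane, (∀ o, ∀ v ∈ R o, ‖v‖ = 1) →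
      ∀ u ∈ T.K.vertices, ∀ B : WSP.Bundle T R u, B.depth + B.p ≤ T.n ^ 2 →
      ∀ r' r'' : WSP.Ray T, B.HasRay r' → B.HasRay r'' →
        WSP.Successive (R B.source) (r'.dir 0) (r''.dir 0) →
        r'.AwayFromCritical ε → r''.AwayFromCritical ε →
        InnerProductGeometry.angle (r'.dir 0) (r''.dir 0) ≤ ε ^ (T.n ^ 2) * ε / (2 * T.mu) →
      ∀ (d : ℝ) (q' q'' : WSP.Plane), r'.PointAt d q' → r''.PointAt d q'' →
        T.segmentCost q' q'' ≤ d * ε := by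
  -- Sources, lengths and encoded face sequences form finite families fixed by `T` alone, so one
  -- threshold serves them all.
  have hev : ∀ᶠ ε in 𝓝[>] (0 : ℝ), ∀ o ∈ T.sources (T.n ^ 2), ∀ p ∈ Set.Iic (T.n ^ 2),
      ∀ F : Fin (T.n ^ 2 + 1) → T.triangles, ∀ r r' : WSP.Ray T,
      WSP.Traverses r o p (WSP.WeightedTriangulation.facesOf F) →
      WSP.Traverses r' o p (WSP.WeightedTriangulation.facesOf F) →
      r.AwayFromCritical ε → r'.AwayFromCritical ε →
      InnerProductGeometry.angle (r.dir 0) (r'.dir 0) ≤ ε ^ (T.n ^ 2) * ε / (2 * T.mu) →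
      ∀ (d : ℝ) (q q' : WSP.Plane), r.PointAt d q → r'.PointAt d q' →
        T.segmentCost q q' ≤ d * ε := by
    rw [Filter.eventually_all_finite (T.finite_sources _)]
    intro o _
    rw [Filter.eventually_all_finite (Set.finite_Iic _)]
    intro p hp
    rw [Filter.eventually_all]
    exact fun F => WSP.eventually_segmentCost_le T o p _ hp
  obtain ⟨ε₀, hε₀, hsub⟩ := mem_nhdsGT_iff_exists_Ioc_subset.mp hev
  refine ⟨ε₀, hε₀, fun ε hε hle R _ u _ B hB r' r'' hr' hr'' _ ha' ha'' hang => ?_⟩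
  obtain ⟨F, hF⟩ := T.exists_facesOf (p := B.p) (face := B.face) (N := T.n ^ 2) (by omega)
    (fun i hi => hr'.1.2.2 i hi ▸ r'.face_mem i (hr'.1.2.1.symm ▸ hi))
  exact hsub ⟨hε, hle⟩ B.source ⟨R, u, B.depth, _, by omega, B.isSource⟩ B.p
    (Set.mem_Iic.mpr (by omega)) F r' r''
    ⟨hr'.1.1, hr'.1.2.1, fun i hi => (hr'.1.2.2 i hi).trans (hF i hi)⟩
    ⟨hr''.1.1, hr''.1.2.1, fun i hi => (hr''.1.2.2 i hi).trans (hF i hi)⟩ ha' ha'' hang
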